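/- **Setting.** An assignment game is a finite bipartite graph $G=(U,V,E)$, $E\neq\emptyset$, with positive edge weights $w:E\to\mathbb R_{>0}$ (in particular, rational weights are allowed). The worth $c(S)$ of $S\subseteq U\cup V$ is the maximum weight of a matching in the subgraph induced on $S$. A core imputation is $p:U\cup V\to\mathbb R_{\ge 0}$ with $\sum_q p(q)=c(U\cup V)$ and $\sum_{q\in S}p(q)\ge c(S)$ for all $S$. A vertex is *essential* if every maximum weight matching (MWM) matches it. An edge is *essential* if it is in every MWM, *viable* if it is in some but not all MWMs, *subpar* if it is in none. An edge $(i,j)$ is *tight* for $p$ if $p(i)+p(j)=w_{ij}$. A *leximin core imputation* is a core imputation whose increasingly sorted list of profits of essential vertices is lexicographically largest among all core imputations. Let $T_0$ be the set of essential and viable edges. A connected component of $(U\cup V,T_0)$ is a *unique imputation component* if the profits of its vertices are the same in all core imputations; otherwise it is *fundamental*. For a set $D$ of vertices, $\mathrm{left}(D)$ and $\mathrm{right}(D)$ are the essential vertices of $D$ in $U$ and in $V$, and $\min(D)$ is the smallest current profit of an essential vertex in $D$. $D$ *has min on both sides* (is fully repaired) if both $\mathrm{left}(D)$ and $\mathrm{right}(D)$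 contain a vertex of profit $\min(D)$; if only one side does, $D$ *has min on* that side. **Mechanism.** Initialize: the current imputation is an arbitrary core imputation; $T=T_0$; Frozen consists of the unique imputation components, Bin of the fundamental components, Active and Fully-Repaired are empty; $\Omega$ is the minimum profit of an essential vertex. Components below are those of $H=(U\cup V,T)$. Each component $D$ in Active is a rooted tree of fundamental components joined by added edges. While Bin $\cup$ Active $\ne\emptyset$, raise $\Omega$ at unit rate and simultaneously rotate each component $D$ in Active: if $D$ has min on the left, increase $\mathrm{left}(D)$ and decrease $\mathrm{right}(D)$ at unit rate; if it has min on the right, do the opposite. Before $\Omega$ is raised any further, execute all events that are due, simultaneous ones in any order: * (a) If a component $C$ in Bin has $\min(C)=\Omega$, move it to Active as the root of a new tree. * (b) If a component $D$ in Active, with root $C_0$, has min on both sides, let $S$ be the set of fundamental components $C_i$ in $D$ with $\min(C_i)=\min(C_0)$ such that this minimum is attained in $C_i$ on a side opposite to one on which $C_0$ attained its minimum when it moved to Active. Move $C_0$, all of $S$, and all components on the tree paths from $C_0$ to $S$ to Fully-Repaired. * (c) Suppose there is a *legitimate* edge: a tight subpar edge $(i,j)$ with $i$ in a component $C$ in Active,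 $j$ in another component $C'$ of $H$, where $C$ has min on one side and $i$ lies on the other side of $C$. Let $P$ be the tree path in $C$ from its root to the fundamental component containing $i$. * If $C'$ is in Bin, add the edge to $T$ and move $C'$ to Active, as a child of the fundamental component containing $i$. * If $C'$ is in Active and $C,C'$ have min on opposite sides, add the edge to $T$ and move $P$ and the analogous path in $C'$ (from its root to the fundamental component containing $j$) to Fully-Repaired. (If $C'$ is in Active and $C,C'$ do not have min on opposite sides, no action is due.) * If $C'$ is in Frozen, respectively Fully-Repaired, add the edge to $T$ and move $P$ (together with $C'$) to Frozen, respectively Fully-Repaired. In (b) and in the last two cases of (c), the remaining fundamental components of the Active components involved are moved back to Bin, and every added edge incident to them is removed from $T$. When Bin $\cup$ Active $=\emptyset$, output the current imputation and halt. **Theorem.** There is exactly one leximin core imputation $y$. Let $a_1<\dots<a_k$ be the distinct profits that $y$ assigns to essential vertices, and $W_l=\{q\in U\cup V: y(q)=a_l\}$. Then, for every starting core imputation and every order of executing simultaneous events: 1. the current imputation is always in the core, and for all $1\le l\le k$ and $\varepsilon>0$, whenever $\Omega=a_l+\varepsilon$ during the run, the current imputation agrees with $y$ on $W_1\cup\dots\cup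 W_l$; 2. the mechanism executes only finitely many steps (events, and raisings of $\Omega$ to the next event), it is never stuck before halting, and it halts by time $\Omega=a_k+\varepsilon$ for every $\varepsilon>0$; 3. its output is $y$. -/

import Mathlib

/-- An assignment game: a finite bipartite graph with sides `U`, `V`, edge set `edges`, and a
positive weight on every edge. -/
structure AssignmentGame (U V : Type*) where
  edges : Finset (U × V)
  weight : U × V → ℝ
  weight_pos : ∀ e ∈ edges, 0 < weight e

namespace AssignmentGame

noncomputable section

/-- The two sides of the bipartition; `left` is `U`, `right` is `V`. -/
inductive Side
  | left
  | right

/-- The opposite side. -/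
def Side.opp : Side → Side
  | .left => .right
  | .right => .left

/-- The side on which a vertex (agent) lies. -/
def sideOf {U V : Type*} : U ⊕ V → Side
  | .inl _ => .left
  | .inr _ => .right

section Game

variable {U V : Type*} (G : AssignmentGame U V)

/-! ### Matchings, worth, core -/

/-- `M` is a matching of the bipartite graph. -/
def IsMatching (M : Finset (U × V)) : Prop :=
  M ⊆ G.edges ∧ ∀ e ∈ M, ∀ f ∈ M, (e.1 = f.1 ∨ e.2 = f.2) → e = f

/-- `M` uses only vertices of the sub-coalition `S`. -/
def Within (M : Finset (U × V)) (S : Finset (U ⊕ V)) : Prop :=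
  ∀ e ∈ M, Sum.inl e.1 ∈ S ∧ Sum.inr e.2 ∈ S

/-- The total weight of a set of edges. -/
def totalWeight (M : Finset (U × V)) : ℝ := ∑ e ∈ M, G.weight e

open Classical in
/-- The matchings of the graph restricted to the sub-coalition `S`. -/
def matchingsIn (S : Finset (U ⊕ V)) : Finset (Finset (U × V)) :=
  G.edges.powerset.filter fun M => G.IsMatching M ∧ Within M S

theorem matchingsIn_nonempty (S : Finset (U ⊕ V)) : (G.matchingsIn S).Nonempty :=
  ⟨∅, by
    classical
    exact Finset.mem_filter.2 ⟨Finset.empty_mem_powerset _,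
      ⟨Finset.empty_subset _, fun e he => absurd he (Finset.notMem_empty e)⟩,
      fun e he => absurd he (Finset.notMem_empty e)⟩⟩

/-- The worth of the sub-coalition `S`: the weight of a maximum weight matching in the graph
restricted to `S`. -/
def worth (S : Finset (U ⊕ V)) : ℝ :=
  (G.matchingsIn S).sup' (G.matchingsIn_nonempty S) G.totalWeight

/-- A maximum weight matching of the whole graph. -/
def IsMaxMatching (M : Finset (U × V)) : Prop :=
  G.IsMatching M ∧ ∀ N, G.IsMatching N → G.totalWeight N ≤ G.totalWeight M

/-- An imputation: nonnegative profits which add up to the worth of the grand coalition. -/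
def IsImputation [Fintype U] [Fintype V] (p : U ⊕ V → ℝ) : Prop :=
  (∀ q, 0 ≤ p q) ∧ ∑ q, p q = G.worth Finset.univ

/-- An imputation in the core. -/
def IsCore [Fintype U] [Fintype V] (p : U ⊕ V → ℝ) : Prop :=
  G.IsImputation p ∧ ∀ S : Finset (U ⊕ V), G.worth S ≤ ∑ q ∈ S, p q

/-! ### Essential, viable and subpar vertices and edges -/

/-- The vertex `q` is matched by `M`. -/
def Matched (M : Finset (U × V)) (q : U ⊕ V) : Prop :=
  ∃ e ∈ M, q = Sum.inl e.1 ∨ q = Sum.inr e.2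

/-- An essential vertex is matched in every maximum weight matching. -/
def EssentialVertex (q : U ⊕ V) : Prop := ∀ M, G.IsMaxMatching M → Matched M q

/-- An essential edge belongs to every maximum weight matching. -/
def EssentialEdge (e : U × V) : Prop := e ∈ G.edges ∧ ∀ M, G.IsMaxMatching M → e ∈ M

/-- A viable edge belongs to some but not to all maximum weight matchings. -/
def ViableEdge (e : U × V) : Prop :=
  e ∈ G.edges ∧ (∃ M, G.IsMaxMatching M ∧ e ∈ M) ∧ ∃ M, G.IsMaxMatching M ∧ e ∉ M

/-- A subpar edge belongs to no maximum weight matching. -/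
def SubparEdge (e : U × V) : Prop := e ∈ G.edges ∧ ∀ M, G.IsMaxMatching M → e ∉ M

/-! ### Leximin core imputations -/

open Classical in
/-- The finite set of essential vertices. -/
def essentialVertices [Fintype U] [Fintype V] : Finset (U ⊕ V) :=
  Finset.univ.filter G.EssentialVertex

/-- The profits of the essential vertices, with multiplicity, sorted increasingly. -/
def sortedProfits [Fintype U] [Fintype V] (p : U ⊕ V → ℝ) : List ℝ :=
  (G.essentialVertices.val.map p).sort (· ≤ ·)

/-- A leximin core imputation: its sorted list of profits of essential vertices is
lexicographically largest among all core imputations. -/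
def IsLeximin [Fintype U] [Fintype V] (p : U ⊕ V → ℝ) : Prop :=
  G.IsCore p ∧ ∀ p', G.IsCore p' →
    G.sortedProfits p' = G.sortedProfits p ∨
      List.Lex (· < ·) (G.sortedProfits p') (G.sortedProfits p)

/-- The set of distinct profit shares which `p` assigns to essential vertices. -/
def shareSet [Fintype U] [Fintype V] (p : U ⊕ V → ℝ) : Finset ℝ :=
  G.essentialVertices.image p

/-- The distinct profit shares `share 0 < share 1 < ⋯` of essential vertices under `p`. -/
def share [Fintype U] [Fintype V] (p : U ⊕ V → ℝ) : Fin (G.shareSet p).card ↪o ℝ :=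
  (G.shareSet p).orderEmbOfFin rfl

/-- The current imputation `p` agrees with `y` on all vertices whose share under `y` is one of the
first `l` distinct shares (up to and including index `l`). -/
def AgreesUpTo [Fintype U] [Fintype V] (y : U ⊕ V → ℝ) (l : Fin (G.shareSet y).card)
    (p : U ⊕ V → ℝ) : Prop :=
  ∀ j ≤ l, ∀ q, y q = G.share y j → p q = y q

/-! ### Tight subgraphs and their components -/

/-- The subgraph on all vertices with edge set `T`. -/
def subgraphOf (T : Set (U × V)) : SimpleGraph (U ⊕ V) where
  Adj a b := ∃ e ∈ T, (a = Sum.inl e.1 ∧ b = Sum.inr e.2) ∨ (a = Sum.inr e.2 ∧ b = Sum.inl e.1)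
  symm := ⟨by
    rintro a b ⟨e, he, h⟩
    exact ⟨e, he, h.symm.imp (fun h => ⟨h.2, h.1⟩) (fun h => ⟨h.2, h.1⟩)⟩⟩
  loopless := ⟨by
    rintro a ⟨e, -, ⟨h, h'⟩ | ⟨h, h'⟩⟩ <;> simp [h] at h'⟩

/-- The starting set of tight edges: all essential and viable edges. -/
def startEdges : Set (U × V) := {e | G.EssentialEdge e ∨ G.ViableEdge e}

/-- The connected components of the starting tight subgraph. -/
abbrev Comp : Type _ := (subgraphOf G.startEdges).ConnectedComponent

/-- The component of the starting tight subgraph that contains `q`. -/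
def compOf (q : U ⊕ V) : G.Comp := (subgraphOf G.startEdges).connectedComponentMk q

/-- `C` is a unique imputation component: the profits of its vertices are the same in all core
imputations. Components which are not of this kind are called fundamental. -/
def UniqueImputation [Fintype U] [Fintype V] (C : G.Comp) : Prop :=
  ∀ p p', G.IsCore p → G.IsCore p' → ∀ q ∈ C.supp, p q = p' q

/-- The components of the starting tight subgraph that make up the vertex set `D`. -/
def parts (D : Set (U ⊕ V)) : Set G.Comp := {C | C.supp ⊆ D}

/-- `left(D)` and `right(D)`: the essential vertices of `D` on the side `s`. -/
def part (s : Side) (D : Set (U ⊕ V)) : Set (U ⊕ V) :=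
  {q | q ∈ D ∧ G.EssentialVertex q ∧ sideOf q = s}

/-- `min(D)`: the smallest profit share of an essential vertex in `D`. -/
def minShare (p : U ⊕ V → ℝ) (D : Set (U ⊕ V)) : ℝ :=
  sInf (p '' {q | q ∈ D ∧ G.EssentialVertex q})

/-- Some essential vertex of `D` on side `s` has profit `min(D)`. -/
def AttainsMin (p : U ⊕ V → ℝ) (s : Side) (D : Set (U ⊕ V)) : Prop :=
  ∃ q ∈ G.part s D, p q = G.minShare p D

/-- `D` has min on both sides, i.e. it is fully repaired. -/
def MinOnBoth (p : U ⊕ V → ℝ) (D : Set (U ⊕ V)) : Prop :=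
  G.AttainsMin p .left D ∧ G.AttainsMin p .right D

/-- `D` has min in `left(D)` (for `s = left`) or in `right(D)` (for `s = right`), and not on both
sides. -/
def HasMinIn (p : U ⊕ V → ℝ) (s : Side) (D : Set (U ⊕ V)) : Prop :=
  ¬ G.MinOnBoth p D ∧ G.AttainsMin p s D

end Game

/-! ### States of the mechanism -/

/-- Where a component of the starting tight subgraph currently is. -/
inductive Status
  | frozen
  | bin
  | active
  | repaired

/-- A state of the mechanism. -/
structure State {U V : Type*} (G : AssignmentGame U V) where
  /-- the current imputation -/
  profit : U ⊕ V → ℝ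
  /-- the current value of the time variable `Ω` -/
  Ω : ℝ
  /-- the edge set of the tight subgraph `H` -/
  T : Set (U × V)
  /-- the set among Frozen, Bin, Active, Fully-Repaired to which each component belongs -/
  status : G.Comp → Status
  /-- the parent of a component in the tree of its valid component; `none` for a root -/
  parent : G.Comp → Option G.Comp
  /-- the sides on which a root component attained its min when it was moved to Active -/
  entrySides : G.Comp → Set Side

namespace State

variable {U V : Type*} {G : AssignmentGame U V}

/-- The vertex set of the connected component of the tight subgraph `H` that contains `q`. -/
def component (σ : State G) (q : U ⊕ V) : Set (U ⊕ V) :=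
  ((subgraphOf σ.T).connectedComponentMk q).supp

/-- The mechanism has left its main loop: nothing is in Bin or Active. -/
def Halted (σ : State G) : Prop := ∀ C, σ.status C ≠ .bin ∧ σ.status C ≠ .active

/-- `C'` is a descendent of `C`: the reflexive transitive closure of the child relation. -/
def Descendent (σ : State G) (C C' : G.Comp) : Prop :=
  Relation.ReflTransGen (fun A B => σ.parent B = some A) C C'

/-- `C` is intermediate between `A` and its descendent `B`. -/
def Intermediate (σ : State G) (A B C : G.Comp) : Prop :=
  σ.Descendent A C ∧ σ.Descendent C B

/-- `C₀` is the root fundamental component of the valid component `D`. -/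
def IsRoot (σ : State G) (D : Set (U ⊕ V)) (C₀ : G.Comp) : Prop :=
  C₀ ∈ G.parts D ∧ ∀ C ∈ G.parts D, σ.Descendent C₀ C

/-- The components on the tree path from the root of the valid component `D` to `C₁`. -/
def rootPath (σ : State G) (D : Set (U ⊕ V)) (C₁ : G.Comp) : Set G.Comp :=
  {C | ∃ C₀, σ.IsRoot D C₀ ∧ σ.Intermediate C₀ C₁ C}

/-- Those components of `D` whose min equals that of the root `C₀` and is attained on a side
opposite to one on which `C₀` attained its min when it was moved to Active. -/
def counterMin (σ : State G) (D : Set (U ⊕ V)) (C₀ : G.Comp) : Set G.Comp :=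
  {C | C ∈ G.parts D ∧ σ.Descendent C₀ C ∧
    G.minShare σ.profit C.supp = G.minShare σ.profit C₀.supp ∧
    ∃ s ∈ σ.entrySides C₀, G.AttainsMin σ.profit s.opp C.supp}

/-- The minimum fully repaired sub-component of a valid component `D` with min on both sides: the
root `C₀`, the components in `counterMin`, and all components intermediate between them. -/
def minSub1 (σ : State G) (D : Set (U ⊕ V)) : Set G.Comp :=
  {C | ∃ C₀, σ.IsRoot D C₀ ∧ (C = C₀ ∨ ∃ B ∈ σ.counterMin D C₀, σ.Intermediate C₀ B C)}

/-- The minimum fully repaired sub-component of the union of two valid components, containing `x`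
and `y` respectively, joined by an edge between `x` and `y`. -/
def minSub2 (σ : State G) (x y : U ⊕ V) : Set G.Comp :=
  σ.rootPath (σ.component x) (G.compOf x) ∪ σ.rootPath (σ.component y) (G.compOf y)

/-- The minimum fully repaired sub-component of the union of the valid component containing `x`
and the frozen or fully repaired component containing `y`, joined by an edge between `x`
and `y`. -/
def minSub3 (σ : State G) (x y : U ⊕ V) : Set G.Comp :=
  σ.rootPath (σ.component x) (G.compOf x) ∪ G.parts (σ.component y)

open Classical in
/-- With `R` a component of the tight subgraph with edge set `T'`: move the sub-component `M` of
`R` to the set `st`, decompose the rest of `R` into fundamental components, and move these back to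
Bin. The decomposition removes from the tight subgraph every added edge that is incident to the
rest of `R`. -/
def settle (σ : State G) (T' : Set (U × V)) (R M : Set G.Comp) (st : Status) : State G :=
  { σ with
    T := {e | e ∈ T' ∧ (e ∈ G.startEdges ∨
      (G.compOf (Sum.inl e.1) ∉ R \ M ∧ G.compOf (Sum.inr e.2) ∉ R \ M))}
    status := fun C => if C ∈ R then (if C ∈ M then st else .bin) else σ.status C
    parent := fun C => if C ∈ R \ M then none else σ.parent C }

/-- `e` is a legitimate edge: a tight subpar edge with one endpoint `x` in a component `C` in
Active and the other endpoint `y` in another component of the tight subgraph, such that `C` has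
min on one side and `x` is on the other side of `C`. -/
def Legitimate (σ : State G) (e : U × V) (x y : U ⊕ V) : Prop :=
  G.SubparEdge e ∧
  ((x = Sum.inl e.1 ∧ y = Sum.inr e.2) ∨ (x = Sum.inr e.2 ∧ y = Sum.inl e.1)) ∧
  σ.profit (Sum.inl e.1) + σ.profit (Sum.inr e.2) = G.weight e ∧
  σ.status (G.compOf x) = .active ∧
  y ∉ σ.component x ∧
  ∃ s, G.HasMinIn σ.profit s (σ.component x) ∧ x ∈ G.part s.opp (σ.component x)

open Classical in
/-- One execution of an event of the main loop; simultaneous events may be executed in any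
order. -/
inductive Event (σ : State G) : State G → Prop
  /-- A component `C` in Bin with `min(C) = Ω` moves to Active and becomes a root. -/
  | activate (C : G.Comp) (hC : σ.status C = .bin) (hmin : G.minShare σ.profit C.supp = σ.Ω) :
      Event σ { σ with
        status := Function.update σ.status C .active
        parent := Function.update σ.parent C none
        entrySides := Function.update σ.entrySides C {s | G.AttainsMin σ.profit s C.supp} }
  /-- A component in Active is fully repaired. -/
  | repair (x : U ⊕ V) (hx : σ.status (G.compOf x) = .active)
      (hboth : G.MinOnBoth σ.profit (σ.component x)) :
      Event σ (σ.settle σ.T (G.parts (σ.component x)) (σ.minSub1 (σ.component x)) .repaired)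
  /-- A legitimate edge leads to a component in Bin, which becomes a child. -/
  | grow (e : U × V) (x y : U ⊕ V) (he : σ.Legitimate e x y)
      (hy : σ.status (G.compOf y) = .bin) :
      Event σ { σ with
        T := insert e σ.T
        status := Function.update σ.status (G.compOf y) .active
        parent := Function.update σ.parent (G.compOf y) (some (G.compOf x)) }
  /-- A legitimate edge joins two components in Active which have min on opposite sides. -/
  | meet (e : U × V) (x y : U ⊕ V) (he : σ.Legitimate e x y)
      (hy : σ.status (G.compOf y) = .active)
      (hopp : ∃ s : Side, G.HasMinIn σ.profit s (σ.component x) ∧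
        G.HasMinIn σ.profit s.opp (σ.component y)) :
      Event σ (σ.settle (insert e σ.T) (G.parts (σ.component x) ∪ G.parts (σ.component y))
        (σ.minSub2 x y) .repaired)
  /-- A legitimate edge leads to a component in Frozen. -/
  | freeze (e : U × V) (x y : U ⊕ V) (he : σ.Legitimate e x y)
      (hy : σ.status (G.compOf y) = .frozen) :
      Event σ (σ.settle (insert e σ.T) (G.parts (σ.component x) ∪ G.parts (σ.component y))
        (σ.minSub3 x y) .frozen)
  /-- A legitimate edge leads to a component in Fully-Repaired. -/
  | attach (e : U × V) (x y : U ⊕ V) (he : σ.Legitimate e x y)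
      (hy : σ.status (G.compOf y) = .repaired) :
      Event σ (σ.settle (insert e σ.T) (G.parts (σ.component x) ∪ G.parts (σ.component y))
        (σ.minSub3 x y) .repaired)

open Classical in
/-- The rate of change of the profit of `q`. A component in Active with min on the left is rotated
clockwise (`left` increases and `right` decreases at unit rate), one with min on the right is
rotated anti-clockwise; all other profits stay fixed. -/
def rate (σ : State G) (q : U ⊕ V) : ℝ :=
  if σ.status (G.compOf q) = .active ∧ G.EssentialVertex q then
    if G.HasMinIn σ.profit (sideOf q) (σ.component q) then 1
    else if G.HasMinIn σ.profit (sideOf q).opp (σ.component q) then -1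
    else 0
  else 0

/-- Raise `Ω` by `t` at unit rate while repairing the components in Active. -/
def advance (σ : State G) (t : ℝ) : State G :=
  { σ with
    profit := fun q => σ.profit q + t * σ.rate q
    Ω := σ.Ω + t }

/-- Some event can be executed. -/
def EventDue (σ : State G) : Prop := ∃ σ', Event σ σ'

/-- Starting from the non-halted state `σ`, raising `Ω` continuously, the first event becomes due
after a positive amount of time `δ`. -/
def NextEventAfter (σ : State G) (δ : ℝ) : Prop :=
  ¬ σ.Halted ∧ 0 < δ ∧ (σ.advance δ).EventDue ∧ ∀ t, 0 ≤ t → t < δ → ¬ (σ.advance t).EventDue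

/-- One step of the mechanism: execute an event, or, if no event is due, raise `Ω` until the next
time at which an event is due. -/
inductive Step (σ : State G) : State G → Prop
  | event (σ' : State G) (h : Event σ σ') : Step σ σ'
  | raise (δ : ℝ) (h : σ.NextEventAfter δ) : Step σ (σ.advance δ)

/-- `τ` is reached from `σ` by steps of the mechanism. -/
def Reaches (σ τ : State G) : Prop := Relation.ReflTransGen Step σ τ

/-- `τ` occurs in a run from `σ`: it is reached by steps, or it is passed through while `Ω` is
being raised continuously in such a step. -/
def Occurs (σ τ : State G) : Prop :=
  ∃ ρ, σ.Reaches ρ ∧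
    (τ = ρ ∨ ∃ δ, ρ.NextEventAfter δ ∧ ∃ t, 0 ≤ t ∧ t ≤ δ ∧ τ = ρ.advance t)

end State

open Classical in
/-- The state of the mechanism after its initialization with the core imputation `p`: unique
imputation components are in Frozen, fundamental components are in Bin, and `Ω` is the minimum
profit share of an essential vertex. -/
def startState {U V : Type*} [Fintype U] [Fintype V] (G : AssignmentGame U V) (p : U ⊕ V → ℝ) :
    State G where
  profit := p
  Ω := G.minShare p Set.univ
  T := G.startEdges
  status := fun C => if G.UniqueImputation C then .frozen else .bin
  parent := fun _ => none
  entrySides := fun _ => ∅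

end

end AssignmentGame

/-! Linear programming duality describes the core by local conditions: profits are nonnegative,
every edge is covered, essential and viable edges are tight, and nonessential vertices get zero.
Nonemptiness (`exists_isCore`) comes from a minimum fractional cover and Hall's theorem.
Consequently two core imputations differ on a component of the starting subgraph by a rotation: one
side changes by some amount, the other by its negative (`gain_eq_gain`). Along an edge that is tight
for the current imputation, the gain of a competitor, measured on the side of one end, does not
decrease towards that end (`gain_le_gain`).

The proof rests on the invariant `Valid`. Its decisive clause is rigidity. Every settled component
has a threshold θ, at most Ω and at most each essential profit in the component; a core imputation
that at each vertex is at least θ or equals the current profit must agree with the current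
imputation on that component. Settling creates rigidity for the following reason. The root of a tree
attains Ω on its entry side, so a competitor that respects the threshold Ω has nonnegative gain
there. Tree edges are oriented so that this gain grows from parent to child. A vertex at Ω on the
opposite side, a tree with the opposite orientation, or an already rigid neighbour bounds the gain
from above by zero at the far end. All gains on the path from the root are then squeezed to zero.

In a halted state everything is rigid. A competing core imputation must therefore have, on the
vertices where it differs, a strictly smaller minimum than the output, and so loses
lexicographically (`Valid.lex_of_halted`). This makes the output leximin, unique and independent of
the run.

Between events all constraints are affine in time, and no event is due exactly when the constraints
being approached are strict (`Valid.quiet`, `Valid.not_eventDue`). Hence Ω can always be raised to a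
first event (`Valid.exists_nextEventAfter`), and a natural number that drops at every step gives
termination. For progress, any valid state is continued to a halt. Its settled profits are already
those of the output and its unsettled ones end at Ω or above (`Valid.settles`), which gives both the
agreement on low levels and the time bound. -/

namespace AssignmentGame

/-! ### Sides -/

@[simp] theorem Side.opp_opp (s : Side) : s.opp.opp = s := by cases s <;> rfl

theorem Side.ne_opp (s : Side) : s ≠ s.opp := by cases s <;> simp [Side.opp]

theorem Side.opp_ne (s : Side) : s.opp ≠ s := s.ne_opp.symm

theorem Side.eq_or_eq_opp (s t : Side) : t = s ∨ t = s.opp := by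
  cases s <;> cases t <;> simp [Side.opp]

section Core

variable {U V : Type*} (G : AssignmentGame U V)

/-! ### Matchings and duality -/

theorem mem_matchingsIn {S : Finset (U ⊕ V)} {M : Finset (U × V)} :
    M ∈ G.matchingsIn S ↔ G.IsMatching M ∧ Within M S := by
  classical
  simp only [matchingsIn, Finset.mem_filter, Finset.mem_powerset]
  exact ⟨fun h => h.2, fun h => ⟨h.1.1, h⟩⟩

theorem within_univ [Fintype U] [Fintype V] (M : Finset (U × V)) : Within M Finset.univ :=
  fun _ _ => ⟨Finset.mem_univ _, Finset.mem_univ _⟩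

theorem isMatching_singleton {e : U × V} (he : e ∈ G.edges) : G.IsMatching {e} := by
  refine ⟨by simpa using he, fun a ha b hb _ => ?_⟩
  rw [Finset.mem_singleton.1 ha, Finset.mem_singleton.1 hb]

theorem totalWeight_le_worth {S : Finset (U ⊕ V)} {M : Finset (U × V)} (hM : G.IsMatching M)
    (hS : Within M S) : G.totalWeight M ≤ G.worth S :=
  Finset.le_sup' _ (G.mem_matchingsIn.2 ⟨hM, hS⟩)

theorem exists_totalWeight_eq_worth (S : Finset (U ⊕ V)) :
    ∃ M, G.IsMatching M ∧ Within M S ∧ G.totalWeight M = G.worth S := by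
  obtain ⟨M, hM, h⟩ := Finset.exists_mem_eq_sup' (G.matchingsIn_nonempty S) G.totalWeight
  rw [mem_matchingsIn] at hM
  exact ⟨M, hM.1, hM.2, h.symm⟩

theorem IsMaxMatching.totalWeight_eq [Fintype U] [Fintype V] {G : AssignmentGame U V}
    {M : Finset (U × V)} (hM : G.IsMaxMatching M) : G.totalWeight M = G.worth Finset.univ := by
  obtain ⟨N, hN, -, h⟩ := G.exists_totalWeight_eq_worth Finset.univ
  exact le_antisymm (G.totalWeight_le_worth hM.1 (within_univ M)) (h ▸ hM.2 N hN)

theorem exists_isMaxMatching [Fintype U] [Fintype V] : ∃ M, G.IsMaxMatching M := by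
  obtain ⟨M, hM, -, h⟩ := G.exists_totalWeight_eq_worth Finset.univ
  exact ⟨M, hM, fun N hN => h ▸ G.totalWeight_le_worth hN (within_univ N)⟩

open Classical in
/-- The vertices matched by `M`. -/
noncomputable def matchedFinset (M : Finset (U × V)) : Finset (U ⊕ V) :=
  (M.image Prod.fst).disjSum (M.image Prod.snd)

theorem mem_matchedFinset {M : Finset (U × V)} {q : U ⊕ V} :
    q ∈ matchedFinset M ↔ Matched M q := by
  classical
  cases q <;> simp [matchedFinset, Matched, eq_comm]

theorem IsMatching.sum_eq {G : AssignmentGame U V} {M : Finset (U × V)} (hM : G.IsMatching M)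
    (p : U ⊕ V → ℝ) :
    ∑ e ∈ M, (p (.inl e.1) + p (.inr e.2)) = ∑ q ∈ matchedFinset M, p q := by
  classical
  rw [matchedFinset, Finset.sum_disjSum, Finset.sum_add_distrib, Finset.sum_image, Finset.sum_image]
  · exact fun a ha b hb h => hM.2 a ha b hb (.inr h)
  · exact fun a ha b hb h => hM.2 a ha b hb (.inl h)

theorem mem_edges_of_mem_startEdges {G : AssignmentGame U V} {e : U × V} (he : e ∈ G.startEdges) :
    e ∈ G.edges :=
  he.elim (fun h => h.1) fun h => h.1

/-- Weak duality, localized to a coalition. -/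
theorem totalWeight_le_sum {p : U ⊕ V → ℝ} (h0 : ∀ q, 0 ≤ p q)
    (hw : ∀ e ∈ G.edges, G.weight e ≤ p (.inl e.1) + p (.inr e.2))
    {S : Finset (U ⊕ V)} {M : Finset (U × V)} (hM : G.IsMatching M) (hS : Within M S) :
    G.totalWeight M ≤ ∑ q ∈ S, p q := by
  calc G.totalWeight M ≤ ∑ e ∈ M, (p (.inl e.1) + p (.inr e.2)) :=
        Finset.sum_le_sum fun e he => hw e (hM.1 he)
    _ = ∑ q ∈ matchedFinset M, p q := hM.sum_eq p
    _ ≤ ∑ q ∈ S, p q := by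
        refine Finset.sum_le_sum_of_subset_of_nonneg (fun q hq => ?_) fun q _ _ => h0 q
        obtain ⟨e, he, rfl | rfl⟩ := mem_matchedFinset.1 hq
        exacts [(hS e he).1, (hS e he).2]

variable [Fintype U] [Fintype V]

/-- A matching as heavy as the cover certifies that both are optimal; the coalition constraints are
weak duality on each coalition. -/
theorem isCore_of_sum_le {p : U ⊕ V → ℝ} (h0 : ∀ q, 0 ≤ p q)
    (hw : ∀ e ∈ G.edges, G.weight e ≤ p (.inl e.1) + p (.inr e.2))
    {M : Finset (U × V)} (hM : G.IsMatching M) (h : ∑ q, p q ≤ G.totalWeight M) :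
    G.IsCore p := by
  have key : ∀ S : Finset (U ⊕ V), G.worth S ≤ ∑ q ∈ S, p q := fun S => by
    obtain ⟨N, hN, hS, h⟩ := G.exists_totalWeight_eq_worth S
    exact h ▸ G.totalWeight_le_sum h0 hw hN hS
  exact ⟨⟨h0, le_antisymm (h.trans (G.totalWeight_le_worth hM (within_univ M))) (key _)⟩, key⟩

variable {G}

theorem IsCore.nonneg {p : U ⊕ V → ℝ} (hp : G.IsCore p) (q : U ⊕ V) : 0 ≤ p q := hp.1.1 q

theorem IsCore.weight_le {p : U ⊕ V → ℝ} (hp : G.IsCore p) {e : U × V} (he : e ∈ G.edges) :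
    G.weight e ≤ p (.inl e.1) + p (.inr e.2) := by
  classical
  have h := hp.2 {.inl e.1, .inr e.2}
  rw [Finset.sum_pair (by simp)] at h
  refine le_trans ?_ h
  have := G.totalWeight_le_worth (S := {.inl e.1, .inr e.2}) (G.isMatching_singleton he)
    (by intro a ha; rw [Finset.mem_singleton.1 ha]; simp)
  simpa [totalWeight] using this

/-- Complementary slackness: the weight of the matching equals the total profit, so no inequality
between the two sums can be strict. -/
theorem IsCore.slackness {p : U ⊕ V → ℝ} (hp : G.IsCore p) {M : Finset (U × V)}
    (hM : G.IsMaxMatching M) :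
    (∀ e ∈ M, p (.inl e.1) + p (.inr e.2) = G.weight e) ∧ ∀ q, ¬ Matched M q → p q = 0 := by
  classical
  have h1 : ∀ e ∈ M, G.weight e ≤ p (.inl e.1) + p (.inr e.2) :=
    fun e he => hp.weight_le (hM.1.1 he)
  have h2 := Finset.sum_le_sum h1
  have h3 := Finset.sum_add_sum_compl (matchedFinset M) p
  have h4 : 0 ≤ ∑ q ∈ (matchedFinset M)ᶜ, p q := Finset.sum_nonneg fun q _ => hp.nonneg q
  have h5 := hM.1.sum_eq p
  have h6 : ∑ e ∈ M, G.weight e = ∑ q, p q := hM.totalWeight_eq.trans hp.1.2.symm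
  refine ⟨fun e he => ?_, fun q hq => ?_⟩
  · exact ((Finset.sum_eq_sum_iff_of_le h1).1 (by linarith) e he).symm
  · refine (Finset.sum_eq_zero_iff_of_nonneg fun q _ => hp.nonneg q).1
      (show ∑ q ∈ (matchedFinset M)ᶜ, p q = 0 by linarith) q ?_
    rwa [Finset.mem_compl, mem_matchedFinset]

theorem exists_mem_of_mem_startEdges {e : U × V} (he : e ∈ G.startEdges) :
    ∃ M, G.IsMaxMatching M ∧ e ∈ M := by
  obtain h | h := he
  · obtain ⟨M, hM⟩ := G.exists_isMaxMatching
    exact ⟨M, hM, h.2 M hM⟩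
  · exact h.2.1

theorem mem_startEdges_of_mem {M : Finset (U × V)} (hM : G.IsMaxMatching M) {e : U × V}
    (he : e ∈ M) : e ∈ G.startEdges := by
  by_cases h : ∀ N, G.IsMaxMatching N → e ∈ N
  · exact .inl ⟨hM.1.1 he, h⟩
  · push Not at h
    exact .inr ⟨hM.1.1 he, ⟨M, hM, he⟩, h⟩

theorem subparEdge_of_notMem {e : U × V} (he : e ∈ G.edges) (h : e ∉ G.startEdges) :
    G.SubparEdge e :=
  ⟨he, fun _ hM heM => h (mem_startEdges_of_mem hM heM)⟩

theorem IsCore.tight {p : U ⊕ V → ℝ} (hp : G.IsCore p) {e : U × V} (he : e ∈ G.startEdges) :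
    p (.inl e.1) + p (.inr e.2) = G.weight e := by
  obtain ⟨M, hM, h⟩ := exists_mem_of_mem_startEdges he
  exact (hp.slackness hM).1 e h

theorem IsCore.eq_zero {p : U ⊕ V → ℝ} (hp : G.IsCore p) {q : U ⊕ V}
    (hq : ¬ G.EssentialVertex q) : p q = 0 := by
  simp only [EssentialVertex, not_forall] at hq
  obtain ⟨M, hM, h⟩ := hq
  exact (hp.slackness hM).2 q h

/-- Together with `IsCore.tight` and `IsCore.eq_zero` this characterizes the core by local
conditions, the form in which membership survives rotations. -/
theorem isCore_of_tight {p : U ⊕ V → ℝ} (h0 : ∀ q, 0 ≤ p q)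
    (hw : ∀ e ∈ G.edges, G.weight e ≤ p (.inl e.1) + p (.inr e.2))
    (ht : ∀ e ∈ G.startEdges, p (.inl e.1) + p (.inr e.2) = G.weight e)
    (hz : ∀ q, ¬ G.EssentialVertex q → p q = 0) : G.IsCore p := by
  classical
  obtain ⟨M, hM⟩ := G.exists_isMaxMatching
  refine G.isCore_of_sum_le h0 hw hM.1 (le_of_eq ?_)
  rw [← Finset.sum_add_sum_compl (matchedFinset M) p, ← hM.1.sum_eq p, Finset.sum_eq_zero (s := _ᶜ),
    add_zero]
  · exact Finset.sum_congr rfl fun e he => ht e (mem_startEdges_of_mem hM he)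
  · intro q hq
    rw [Finset.mem_compl, mem_matchedFinset] at hq
    exact hz q fun h => hq (h M hM)

/-! ### The core is nonempty -/

variable (G)

/-- The feasible solutions of the linear program dual to maximum weight matching. -/
def covers : Set (U ⊕ V → ℝ) :=
  {p | (∀ q, 0 ≤ p q) ∧ ∀ e ∈ G.edges, G.weight e ≤ p (.inl e.1) + p (.inr e.2)}

theorem exists_min_cover : ∃ p ∈ G.covers, ∀ p' ∈ G.covers, ∑ q, p q ≤ ∑ q, p' q := by
  set B : ℝ := ∑ e ∈ G.edges, G.weight e
  have hB : ∀ e ∈ G.edges, G.weight e ≤ B := fun e he =>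
    Finset.single_le_sum (f := G.weight) (fun f hf => (G.weight_pos f hf).le) he
  have hB0 : 0 ≤ B := Finset.sum_nonneg fun f hf => (G.weight_pos f hf).le
  have hmem : (fun _ => B) ∈ G.covers :=
    ⟨fun _ => hB0, fun e he => by have := hB e he; linarith⟩
  -- The constant cover has value S. A cover of value at most S lies in a box of side S, so the
  -- minimum may be sought in a compact set.
  set S : ℝ := ∑ _q : U ⊕ V, B
  have hclosed : IsClosed G.covers := by
    have : G.covers = (⋂ q, {p | 0 ≤ p q}) ∩
        ⋂ e ∈ G.edges, {p | G.weight e ≤ p (.inl e.1) + p (.inr e.2)} := by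
      ext p; simp [covers]
    rw [this]
    refine (isClosed_iInter fun q => isClosed_le continuous_const (continuous_apply q)).inter
      (isClosed_biInter fun e _ => isClosed_le continuous_const ?_)
    fun_prop
  have hcomp : IsCompact (Set.Icc (0 : U ⊕ V → ℝ) (fun _ => S) ∩ G.covers) :=
    isCompact_Icc.inter_right hclosed
  have hle : ∀ p ∈ G.covers, ∑ q, p q ≤ S → p ∈ Set.Icc (0 : U ⊕ V → ℝ) (fun _ => S) ∩ G.covers :=
    fun p hp h => ⟨⟨hp.1, fun q =>
      (Finset.single_le_sum (fun r _ => hp.1 r) (Finset.mem_univ q)).trans h⟩, hp⟩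
  obtain ⟨p, hp, hmin⟩ := hcomp.exists_isMinOn ⟨_, hle _ hmem le_rfl⟩
    (f := fun p => ∑ q, p q) (by fun_prop)
  refine ⟨p, hp.2, fun p' hp' => ?_⟩
  by_cases h : ∑ q, p' q ≤ S
  · exact hmin (hle p' hp' h)
  · exact (hmin (hle _ hmem le_rfl)).trans (not_le.1 h).le

/-- The vertices with which `q` can be paired in view of complementary slackness: neighbours along
tight edges, and `q` itself if its price is zero. -/
def SlackPartner (p : U ⊕ V → ℝ) (q r : U ⊕ V) : Prop :=
  (q = r ∧ p q = 0) ∨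
    (∃ e ∈ G.edges, p (.inl e.1) + p (.inr e.2) = G.weight e ∧
      ((q = .inl e.1 ∧ r = .inr e.2) ∨ (q = .inr e.2 ∧ r = .inl e.1)))

-- Hall's condition for the slackness relation. If a set had too few partners, lowering its prices
-- and raising those of its partners by a small amount would give a cheaper cover.
open Classical in
theorem card_le_card_slackPartner {p : U ⊕ V → ℝ} (hp : p ∈ G.covers)
    (hmin : ∀ p' ∈ G.covers, ∑ q, p q ≤ ∑ q, p' q) (S : Finset (U ⊕ V)) :
    S.card ≤ (S.biUnion fun q => Finset.univ.filter (G.SlackPartner p q)).card := by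
  set N := S.biUnion fun q => Finset.univ.filter (G.SlackPartner p q) with hN
  have hSN : ∀ q ∈ S, ∀ r, G.SlackPartner p q r → r ∈ N := fun q hq r h => by
    rw [hN, Finset.mem_biUnion]; exact ⟨q, hq, by simpa using h⟩
  -- This direction changes the total by |N| − |S| and never decreases a tight constraint, since a
  -- vertex of S that meets such a constraint has its partner in N.
  let d : U ⊕ V → ℝ := fun q => (if q ∈ N then 1 else 0) - (if q ∈ S then 1 else 0)
  have hd : ∀ q, -1 ≤ d q := fun q => by dsimp only [d]; split_ifs <;> norm_num
  -- a positive step that respects every constraint which is not tight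
  obtain ⟨ε, hε, h1, h2⟩ : ∃ ε : ℝ, 0 < ε ∧ (∀ q, 0 < p q → ε ≤ p q) ∧
      ∀ e ∈ G.edges, G.weight e < p (.inl e.1) + p (.inr e.2) →
        2 * ε ≤ p (.inl e.1) + p (.inr e.2) - G.weight e := by
    have ha : ∀ᶠ ε : ℝ in nhdsWithin 0 (Set.Ioi 0), ∀ q, 0 < p q → ε ≤ p q := by
      refine Filter.eventually_all.2 fun q => ?_
      by_cases h : 0 < p q
      · filter_upwards [nhdsWithin_le_nhds (Iio_mem_nhds h)] with ε hε _ using le_of_lt hε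
      · exact Filter.Eventually.of_forall fun _ h' => absurd h' h
    have hb : ∀ᶠ ε : ℝ in nhdsWithin 0 (Set.Ioi 0), ∀ e : U × V, e ∈ G.edges →
        G.weight e < p (.inl e.1) + p (.inr e.2) →
        2 * ε ≤ p (.inl e.1) + p (.inr e.2) - G.weight e := by
      refine Filter.eventually_all.2 fun e => ?_
      by_cases h : G.weight e < p (.inl e.1) + p (.inr e.2)
      · have : 0 < (p (.inl e.1) + p (.inr e.2) - G.weight e) / 2 := by linarith
        filter_upwards [nhdsWithin_le_nhds (Iio_mem_nhds this)] with ε hε _ _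
        have : ε < _ := hε
        linarith
      · exact Filter.Eventually.of_forall fun _ _ h' => absurd h' h
    obtain ⟨ε, h⟩ := (ha.and (hb.and self_mem_nhdsWithin)).exists
    exact ⟨ε, h.2.2, h.1, h.2.1⟩
  have hcov : (fun q => p q + ε * d q) ∈ G.covers := by
    refine ⟨fun q => ?_, fun e he => ?_⟩
    · obtain h | h := (hp.1 q).lt_or_eq
      · nlinarith [h1 q h, hd q]
      · have : 0 ≤ d q := by
          by_cases hq : q ∈ S
          · simp [d, hq, hSN q hq q (.inl ⟨rfl, h.symm⟩)]
          · simp only [d, hq, if_false]; split_ifs <;> norm_num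
        have := mul_nonneg hε.le this
        simpa [← h] using this
    · obtain h | h := (hp.2 e he).lt_or_eq
      · nlinarith [h2 e he h, hd (.inl e.1), hd (.inr e.2)]
      · have hl : Sum.inl e.1 ∈ S → Sum.inr e.2 ∈ N := fun hq =>
          hSN _ hq _ (.inr ⟨e, he, h.symm, .inl ⟨rfl, rfl⟩⟩)
        have hr : Sum.inr e.2 ∈ S → Sum.inl e.1 ∈ N := fun hq =>
          hSN _ hq _ (.inr ⟨e, he, h.symm, .inr ⟨rfl, rfl⟩⟩)
        have : 0 ≤ d (.inl e.1) + d (.inr e.2) := by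
          by_cases ha : Sum.inl e.1 ∈ S <;> by_cases hb : Sum.inr e.2 ∈ S <;>
            simp only [d, ha, hb, if_true, if_false, hl, hr] <;>
            (try split_ifs) <;> norm_num
        have := mul_nonneg hε.le this
        simp only
        linarith
  have hsum := hmin _ hcov
  rw [Finset.sum_add_distrib, ← Finset.mul_sum] at hsum
  have hd' : ∑ q, d q = (N.card : ℝ) - S.card := by simp [d]
  rw [hd'] at hsum
  have : (S.card : ℝ) ≤ N.card := by nlinarith
  exact_mod_cast this

/-- Hall's theorem yields a permutation sending each vertex along a tight edge, or to itself when
its price is zero. Its left-to-right and right-to-left arcs form two matchings whose weights add up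
to twice the cover value, so one of them is as heavy as the cover. -/
theorem exists_isCore : ∃ p, G.IsCore p := by
  classical
  obtain ⟨p, hp, hmin⟩ := G.exists_min_cover
  obtain ⟨f, hf, hf'⟩ := (Finset.all_card_le_biUnion_card_iff_exists_injective _).1
    (G.card_le_card_slackPartner hp hmin)
  have hfp : ∀ q, G.SlackPartner p q (f q) := fun q => by simpa using hf' q
  have hbij : Function.Bijective f := Finite.injective_iff_bijective.1 hf
  let M₁ : Finset (U × V) := Finset.univ.filter fun e => f (.inl e.1) = .inr e.2
  let M₂ : Finset (U × V) := Finset.univ.filter fun e => f (.inr e.2) = .inl e.1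
  have hM₁ : G.IsMatching M₁ := by
    constructor
    · intro e he
      have he : f (.inl e.1) = .inr e.2 := by simpa [M₁] using he
      have := hfp (.inl e.1)
      rw [he] at this
      obtain ⟨h, -⟩ | ⟨e', he', -, ⟨h, h'⟩ | ⟨h, -⟩⟩ := this
      · simp at h
      · rwa [show e = e' from Prod.ext (by simpa using h) (by simpa using h')]
      · simp at h
    · intro a ha b hb hab
      have ha : f (.inl a.1) = .inr a.2 := by simpa [M₁] using ha
      have hb : f (.inl b.1) = .inr b.2 := by simpa [M₁] using hb
      have h1 : a.1 = b.1 := hab.elim id fun h => by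
        rw [h, ← hb] at ha
        simpa using hf ha
      rw [h1, hb] at ha
      exact Prod.ext h1 (by simpa using ha.symm)
  have hM₂ : G.IsMatching M₂ := by
    constructor
    · intro e he
      have he : f (.inr e.2) = .inl e.1 := by simpa [M₂] using he
      have := hfp (.inr e.2)
      rw [he] at this
      obtain ⟨h, -⟩ | ⟨e', he', -, ⟨h, -⟩ | ⟨h, h'⟩⟩ := this
      · simp at h
      · simp at h
      · rwa [show e = e' from Prod.ext (by simpa using h') (by simpa using h)]
    · intro a ha b hb hab
      have ha : f (.inr a.2) = .inl a.1 := by simpa [M₂] using ha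
      have hb : f (.inr b.2) = .inl b.1 := by simpa [M₂] using hb
      have h1 : a.2 = b.2 := hab.symm.elim id fun h => by
        rw [h, ← hb] at ha
        simpa using hf ha
      rw [h1, hb] at ha
      exact Prod.ext (by simpa using ha.symm) h1
  have hl : ∀ u : U, p (.inl u) + p (f (.inl u)) =
      ∑ v, if f (.inl u) = .inr v then G.weight (u, v) else 0 := fun u => by
    obtain ⟨h, h0⟩ | ⟨e, -, ht, ⟨h, h'⟩ | ⟨h, -⟩⟩ := hfp (.inl u)
    · rw [← h, h0]; simp
    · obtain rfl : u = e.1 := by simpa using h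
      rw [h', ht]; simp
    · simp at h
  have hr : ∀ v : V, p (.inr v) + p (f (.inr v)) =
      ∑ u, if f (.inr v) = .inl u then G.weight (u, v) else 0 := fun v => by
    obtain ⟨h, h0⟩ | ⟨e, -, ht, ⟨h, -⟩ | ⟨h, h'⟩⟩ := hfp (.inr v)
    · rw [← h, h0]; simp
    · simp at h
    · obtain rfl : v = e.2 := by simpa using h
      rw [h', add_comm, ht]; simp
  have h1 : G.totalWeight M₁ = ∑ u, (p (.inl u) + p (f (.inl u))) := by
    rw [Finset.sum_congr rfl fun u _ => hl u, totalWeight, Finset.sum_filter,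
      Fintype.sum_prod_type]
  have h2 : G.totalWeight M₂ = ∑ v, (p (.inr v) + p (f (.inr v))) := by
    rw [Finset.sum_congr rfl fun v _ => hr v, totalWeight, Finset.sum_filter,
      Fintype.sum_prod_type_right]
  have h3 : G.totalWeight M₁ + G.totalWeight M₂ = ∑ q, p q + ∑ q, p q := by
    nth_rewrite 2 [← hbij.sum_comp p]
    rw [h1, h2, ← Finset.sum_add_distrib, Fintype.sum_sum_type]
  obtain h | h : ∑ q, p q ≤ G.totalWeight M₁ ∨ ∑ q, p q ≤ G.totalWeight M₂ := by
    by_contra! h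
    linarith
  exacts [⟨p, G.isCore_of_sum_le hp.1 hp.2 hM₁ h⟩, ⟨p, G.isCore_of_sum_le hp.1 hp.2 hM₂ h⟩]

end Core

end AssignmentGame

namespace AssignmentGame

/-! ### Edges as pairs of vertices, and components -/

section Components

variable {U V : Type*} {G : AssignmentGame U V}

/-- `x` and `y` are the two ends of `e`. -/
def Joins (e : U × V) (x y : U ⊕ V) : Prop :=
  (x = .inl e.1 ∧ y = .inr e.2) ∨ (x = .inr e.2 ∧ y = .inl e.1)

theorem Joins.symm {e : U × V} {x y : U ⊕ V} (h : Joins e x y) : Joins e y x :=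
  h.elim (fun h => .inr ⟨h.2, h.1⟩) fun h => .inl ⟨h.2, h.1⟩

theorem joins_self (e : U × V) : Joins e (.inl e.1) (.inr e.2) := .inl ⟨rfl, rfl⟩

theorem Joins.sideOf_eq {e : U × V} {x y : U ⊕ V} (h : Joins e x y) :
    sideOf y = (sideOf x).opp := by
  obtain ⟨rfl, rfl⟩ | ⟨rfl, rfl⟩ := h <;> rfl

theorem Joins.add_eq {e : U × V} {x y : U ⊕ V} (h : Joins e x y) (p : U ⊕ V → ℝ) :
    p x + p y = p (.inl e.1) + p (.inr e.2) := by
  obtain ⟨rfl, rfl⟩ | ⟨rfl, rfl⟩ := h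
  · rfl
  · exact add_comm _ _

/-- A function with the same value at both ends of every edge of `T` has the same value at all
vertices of a component. -/
theorem eq_of_mk_eq {α : Type*} {T : Set (U × V)} (f : U ⊕ V → α)
    (hf : ∀ e ∈ T, f (.inl e.1) = f (.inr e.2)) {q r : U ⊕ V}
    (h : (subgraphOf T).connectedComponentMk q = (subgraphOf T).connectedComponentMk r) :
    f q = f r := by
  obtain ⟨w⟩ := SimpleGraph.ConnectedComponent.eq.1 h
  induction w with
  | nil => rfl
  | cons hadj _ ih =>
    obtain ⟨e, he, ⟨rfl, rfl⟩ | ⟨rfl, rfl⟩⟩ := hadj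
    · exact (hf e he).trans (ih (SimpleGraph.ConnectedComponent.eq.2 ⟨by assumption⟩))
    · exact (hf e he).symm.trans (ih (SimpleGraph.ConnectedComponent.eq.2 ⟨by assumption⟩))

theorem mk_eq_mk {T : Set (U × V)} {e : U × V} (he : e ∈ T) :
    (subgraphOf T).connectedComponentMk (.inl e.1) =
      (subgraphOf T).connectedComponentMk (.inr e.2) :=
  SimpleGraph.ConnectedComponent.eq.2 (SimpleGraph.Adj.reachable ⟨e, he, .inl ⟨rfl, rfl⟩⟩)

theorem mem_supp_iff {C : G.Comp} {q : U ⊕ V} : q ∈ C.supp ↔ G.compOf q = C := Iff.rfl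

theorem exists_compOf_eq (C : G.Comp) : ∃ q, G.compOf q = C := C.exists_rep

theorem compOf_eq {e : U × V} (he : e ∈ G.startEdges) :
    G.compOf (.inl e.1) = G.compOf (.inr e.2) := mk_eq_mk he

theorem Joins.compOf_eq {e : U × V} {x y : U ⊕ V} (h : Joins e x y) (he : e ∈ G.startEdges) :
    G.compOf x = G.compOf y := by
  obtain ⟨rfl, rfl⟩ | ⟨rfl, rfl⟩ := h
  exacts [AssignmentGame.compOf_eq he, (AssignmentGame.compOf_eq he).symm]

theorem HasMinIn.eq_of_attainsMin {p : U ⊕ V → ℝ} {D : Set (U ⊕ V)} {s t : Side}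
    (hs : G.HasMinIn p s D) (ht : G.AttainsMin p t D) : t = s := by
  obtain h | rfl := s.eq_or_eq_opp t
  · exact h
  · refine absurd ?_ hs.1
    cases s
    exacts [⟨hs.2, ht⟩, ⟨ht, hs.2⟩]

/-! ### Differences of core imputations -/

open Classical in
/-- How much better `z` is than `p` for the side `s` of the component of `q`. -/
noncomputable def gain (s : Side) (z p : U ⊕ V → ℝ) (q : U ⊕ V) : ℝ :=
  if sideOf q = s then z q - p q else p q - z q

theorem gain_of_eq {s : Side} (z p : U ⊕ V → ℝ) {q : U ⊕ V} (h : sideOf q = s) :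
    gain s z p q = z q - p q := if_pos h

theorem gain_of_eq_opp {s : Side} (z p : U ⊕ V → ℝ) {q : U ⊕ V} (h : sideOf q = s.opp) :
    gain s z p q = p q - z q := if_neg (h ▸ s.opp_ne)

theorem gain_opp (s : Side) (z p : U ⊕ V → ℝ) (q : U ⊕ V) :
    gain s.opp z p q = -gain s z p q := by
  obtain h | h := s.eq_or_eq_opp (sideOf q)
  · rw [gain_of_eq z p h, gain_of_eq_opp z p (s := s.opp) (by simpa using h)]; ring
  · rw [gain_of_eq z p h, gain_of_eq_opp z p h]; ring

theorem gain_eq_zero_iff {s : Side} {z p : U ⊕ V → ℝ} {q : U ⊕ V} :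
    gain s z p q = 0 ↔ z q = p q := by
  obtain h | h := s.eq_or_eq_opp (sideOf q)
  · rw [gain_of_eq z p h, sub_eq_zero]
  · rw [gain_of_eq_opp z p h, sub_eq_zero, eq_comm]

variable [Fintype U] [Fintype V]

/-- An edge of the starting subgraph is tight for both imputations, so their differences at its ends
are opposite; the sign in `gain` absorbs the alternation of sides. -/
theorem gain_eq_gain {z p : U ⊕ V → ℝ} (hz : G.IsCore z) (hp : G.IsCore p) (s : Side)
    {q r : U ⊕ V} (h : G.compOf q = G.compOf r) : gain s z p q = gain s z p r := by
  refine eq_of_mk_eq (T := G.startEdges) _ (fun e he => ?_) h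
  have h1 := hz.tight he
  have h2 := hp.tight he
  obtain hs | hs := s.eq_or_eq_opp (sideOf (Sum.inl e.1 : U ⊕ V))
  · rw [gain_of_eq z p hs, gain_of_eq_opp z p (by rw [(joins_self e).sideOf_eq, hs])]
    linarith
  · rw [gain_of_eq_opp z p hs, gain_of_eq z p (by rw [(joins_self e).sideOf_eq, hs, s.opp_opp])]
    linarith

/-- An edge that is tight for `p` does not let the gain decrease. -/
theorem gain_le_gain {z p : U ⊕ V → ℝ} (hz : G.IsCore z) {e : U × V} (he : e ∈ G.edges)
    (ht : p (.inl e.1) + p (.inr e.2) = G.weight e) {x y : U ⊕ V} (h : Joins e x y) :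
    gain (sideOf y) z p x ≤ gain (sideOf y) z p y := by
  have h1 := hz.weight_le he
  rw [← ht, ← h.add_eq, ← h.add_eq] at h1
  rw [gain_of_eq z p rfl, gain_of_eq_opp z p h.symm.sideOf_eq]
  linarith

/-- A nonessential vertex has profit zero throughout the core, and one pinned vertex pins its whole
component. -/
theorem essentialVertex_of_not_uniqueImputation {C : G.Comp} (hC : ¬ G.UniqueImputation C)
    {q : U ⊕ V} (hq : G.compOf q = C) : G.EssentialVertex q := by
  by_contra h
  refine hC fun p p' hp hp' r hr => ?_
  have := gain_eq_gain hp hp' .left (hq.trans (mem_supp_iff.1 hr).symm)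
  rwa [gain_eq_zero_iff.2 (by rw [hp.eq_zero h, hp'.eq_zero h]), eq_comm, gain_eq_zero_iff] at this

theorem EssentialVertex.exists_opp {q : U ⊕ V} (hq : G.EssentialVertex q) :
    ∃ r, G.compOf r = G.compOf q ∧ sideOf r = (sideOf q).opp := by
  obtain ⟨M, hM⟩ := G.exists_isMaxMatching
  obtain ⟨e, he, rfl | rfl⟩ := hq M hM
  · exact ⟨.inr e.2, (compOf_eq (mem_startEdges_of_mem hM he)).symm, rfl⟩
  · exact ⟨.inl e.1, compOf_eq (mem_startEdges_of_mem hM he), rfl⟩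

theorem EssentialVertex.exists_side {q : U ⊕ V} (hq : G.EssentialVertex q) (s : Side) :
    ∃ r, G.compOf r = G.compOf q ∧ sideOf r = s := by
  obtain h | h := s.eq_or_eq_opp (sideOf q)
  · exact ⟨q, rfl, h⟩
  · obtain ⟨r, hr, hs⟩ := hq.exists_opp
    exact ⟨r, hr, by rw [hs, h, s.opp_opp]⟩

/-! ### The minimum of a set of vertices -/

theorem minShare_le (p : U ⊕ V → ℝ) {D : Set (U ⊕ V)} {q : U ⊕ V} (hq : q ∈ D)
    (he : G.EssentialVertex q) : G.minShare p D ≤ p q :=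
  csInf_le (Set.toFinite _).bddBelow ⟨q, ⟨hq, he⟩, rfl⟩

theorem exists_eq_minShare (p : U ⊕ V → ℝ) {D : Set (U ⊕ V)} {q : U ⊕ V} (hq : q ∈ D)
    (he : G.EssentialVertex q) : ∃ r ∈ D, G.EssentialVertex r ∧ p r = G.minShare p D := by
  have hne : (p '' {q | q ∈ D ∧ G.EssentialVertex q}).Nonempty := ⟨_, q, ⟨hq, he⟩, rfl⟩
  obtain ⟨r, hr, h⟩ := hne.csInf_mem (Set.toFinite _)
  exact ⟨r, hr.1, hr.2, h⟩

theorem minShare_eq {p : U ⊕ V → ℝ} {D : Set (U ⊕ V)} {m : ℝ}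
    (hle : ∀ q ∈ D, G.EssentialVertex q → m ≤ p q) {r : U ⊕ V} (hr : r ∈ D)
    (he : G.EssentialVertex r) (h : p r = m) : G.minShare p D = m := by
  obtain ⟨t, ht, het, h'⟩ := G.exists_eq_minShare p hr he
  exact le_antisymm (h ▸ G.minShare_le p hr he) (h' ▸ hle t ht het)

end Components
end AssignmentGame

/-! ### The invariant of the mechanism and gains along trees -/

namespace AssignmentGame
namespace State

variable {U V : Type*} {G : AssignmentGame U V}

/-- The component `C` is in Bin or in Active. -/
def Unsettled (σ : State G) (C : G.Comp) : Prop := σ.status C = .bin ∨ σ.status C = .active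

/-- `root` assigns to every component in Active the root of its tree. The tree edges are
oriented: the parent is entered on the side opposite to the entry sides of the root. -/
structure IsForest (σ : State G) (root : G.Comp → G.Comp) : Prop where
  root_active : ∀ C, σ.status C = .active → σ.status (root C) = .active
  parent_root : ∀ C, σ.status C = .active → σ.parent (root C) = none
  descendent : ∀ C, σ.status C = .active → σ.Descendent (root C) C
  root_eq : ∀ e ∈ σ.T, σ.status (G.compOf (.inl e.1)) = .active →
    root (G.compOf (.inl e.1)) = root (G.compOf (.inr e.2))
  parent_edge : ∀ A C, σ.status C = .active → σ.parent C = some A →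
    ∃ e ∈ σ.T, ∃ x y, Joins e x y ∧ G.compOf x = A ∧ G.compOf y = C ∧
      ∀ s ∈ σ.entrySides (root C), sideOf y = s
  entry_nonempty : ∀ C, σ.status C = .active → (σ.entrySides (root C)).Nonempty
  entry_attained : ∀ C, σ.status C = .active → ∀ s ∈ σ.entrySides (root C),
    ∃ r, G.compOf r = root C ∧ sideOf r = s ∧ σ.profit r = σ.Ω

/-- Core imputations which are at least `θ` wherever they differ from the current imputation
agree with the current imputation on `C`. -/
def Rigid [Fintype U] [Fintype V] (σ : State G) (θ : ℝ) (C : G.Comp) : Prop :=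
  ∀ z, G.IsCore z → (∀ q, θ ≤ z q ∨ z q = σ.profit q) → ∀ q, G.compOf q = C → z q = σ.profit q

/-- The invariant of the mechanism. -/
structure Valid [Fintype U] [Fintype V] (σ : State G) : Prop where
  core : G.IsCore σ.profit
  nonneg : 0 ≤ σ.Ω
  start_subset : G.startEdges ⊆ σ.T
  mem_edges : ∀ e ∈ σ.T, e ∈ G.edges
  tight : ∀ e ∈ σ.T, σ.profit (.inl e.1) + σ.profit (.inr e.2) = G.weight e
  status_eq : ∀ e ∈ σ.T, σ.status (G.compOf (.inl e.1)) = σ.status (G.compOf (.inr e.2))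
  ne_bin : ∀ e ∈ σ.T, e ∉ G.startEdges → σ.status (G.compOf (.inl e.1)) ≠ .bin
  fundamental : ∀ C, σ.Unsettled C → ¬ G.UniqueImputation C
  le_profit : ∀ q, σ.Unsettled (G.compOf q) → σ.Ω ≤ σ.profit q
  exists_forest : ∃ root, σ.IsForest root
  rigid : ∀ C, ¬ σ.Unsettled C → ∃ θ ≤ σ.Ω,
    (∀ q, G.compOf q = C → G.EssentialVertex q → θ ≤ σ.profit q) ∧ σ.Rigid θ C

/-! ### Components of the current tight subgraph -/

theorem mem_component {σ : State G} {q r : U ⊕ V} : r ∈ σ.component q ↔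
    (subgraphOf σ.T).connectedComponentMk r = (subgraphOf σ.T).connectedComponentMk q := Iff.rfl

theorem mem_component_self (σ : State G) (q : U ⊕ V) : q ∈ σ.component q := rfl

theorem component_eq {σ : State G} {q r : U ⊕ V} (h : r ∈ σ.component q) :
    σ.component r = σ.component q := by
  rw [component, mem_component.1 h, component]

theorem mem_component_of_joins {σ : State G} {e : U × V} {x y : U ⊕ V} (h : Joins e x y)
    (he : e ∈ σ.T) : y ∈ σ.component x := by
  obtain ⟨rfl, rfl⟩ | ⟨rfl, rfl⟩ := h
  exacts [(mk_eq_mk he).symm, mk_eq_mk he]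

theorem le_of_profit_eq {σ : State G} {z : U ⊕ V → ℝ}
    (hle : ∀ q, σ.Ω ≤ z q ∨ z q = σ.profit q) {q : U ⊕ V} (h : σ.profit q = σ.Ω) :
    σ.profit q ≤ z q :=
  (hle q).elim (fun h' => h.trans_le h') fun h' => h'.ge

namespace Valid

variable [Fintype U] [Fintype V] {σ : State G} (hσ : σ.Valid)
include hσ

theorem mem_component_of_compOf_eq {q r : U ⊕ V} (h : G.compOf r = G.compOf q) :
    r ∈ σ.component q :=
  eq_of_mk_eq (T := G.startEdges) _ (fun _ he => mk_eq_mk (hσ.start_subset he)) h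

theorem compOf_mem_parts {q r : U ⊕ V} :
    G.compOf r ∈ G.parts (σ.component q) ↔ r ∈ σ.component q := by
  refine ⟨fun h => h (show r ∈ (G.compOf r).supp from rfl), fun h t ht => ?_⟩
  rw [← component_eq h]
  exact hσ.mem_component_of_compOf_eq ht

theorem status_eq_of_mem {q r : U ⊕ V} (h : r ∈ σ.component q) :
    σ.status (G.compOf r) = σ.status (G.compOf q) :=
  eq_of_mk_eq (fun q => σ.status (G.compOf q)) hσ.status_eq h

theorem parts_closed {q : U ⊕ V} {e : U × V} (he : e ∈ σ.T) :
    G.compOf (.inl e.1) ∈ G.parts (σ.component q) ↔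
      G.compOf (.inr e.2) ∈ G.parts (σ.component q) := by
  rw [hσ.compOf_mem_parts, hσ.compOf_mem_parts, mem_component, mem_component, mk_eq_mk he]

theorem status_eq_of_mem_parts {q : U ⊕ V} {C : G.Comp} (h : C ∈ G.parts (σ.component q)) :
    σ.status C = σ.status (G.compOf q) := by
  obtain ⟨r, rfl⟩ := exists_compOf_eq C
  exact hσ.status_eq_of_mem (hσ.compOf_mem_parts.1 h)

theorem essentialVertex {q : U ⊕ V} (h : σ.Unsettled (G.compOf q)) : G.EssentialVertex q :=
  essentialVertex_of_not_uniqueImputation (hσ.fundamental _ h) rfl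

theorem root_eq_of_mem {root : G.Comp → G.Comp} (hr : σ.IsForest root) {q r : U ⊕ V}
    (h : r ∈ σ.component q) (hq : σ.status (G.compOf q) = .active) :
    root (G.compOf r) = root (G.compOf q) := by
  classical
  -- `root` is controlled only on Active components, so elsewhere it is masked by a default value.
  have := eq_of_mk_eq (T := σ.T) (fun q => if σ.status (G.compOf q) = .active then
    some (root (G.compOf q)) else none) (fun e he => ?_) h
  · simpa [hq, hσ.status_eq_of_mem h] using this
  · by_cases h1 : σ.status (G.compOf (.inl e.1)) = .active
    · simp [h1, ← hσ.status_eq e he, hr.root_eq e he h1]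
    · simp [h1, ← hσ.status_eq e he]

/-- Going up in a tree stays within the tree, and does not increase gains. -/
theorem descendent_active {root : G.Comp → G.Comp} (hr : σ.IsForest root) {A B : G.Comp}
    (h : σ.Descendent A B) (hB : σ.status B = .active) :
    σ.status A = .active ∧ root A = root B ∧
      (∀ a b, G.compOf a = A → G.compOf b = B → a ∈ σ.component b) ∧
      ∀ s ∈ σ.entrySides (root B), ∀ z, G.IsCore z → ∀ a b, G.compOf a = A → G.compOf b = B →
        gain s z σ.profit a ≤ gain s z σ.profit b := by
  induction h with
  | refl =>
    exact ⟨hB, rfl, fun a b ha hb => hσ.mem_component_of_compOf_eq (ha.trans hb.symm),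
      fun s _ z hz a b ha hb => (gain_eq_gain hz hσ.core s (ha.trans hb.symm)).le⟩
  | @tail B C _ hBC ih =>
    obtain ⟨e, he, x, y, hxy, rfl, rfl, hs⟩ := hr.parent_edge B C hB hBC
    have hm : x ∈ σ.component y := mem_component_of_joins hxy.symm he
    have hx : σ.status (G.compOf x) = .active := (hσ.status_eq_of_mem hm).trans hB
    obtain ⟨h1, h2, h3, h4⟩ := ih hx
    have hroot := hσ.root_eq_of_mem hr hm hB
    refine ⟨h1, h2.trans hroot, fun a b ha hb => ?_, fun s hs' z hz a b ha hb => ?_⟩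
    · have := h3 a x ha rfl
      rw [component_eq hm] at this
      rwa [component_eq (hσ.mem_component_of_compOf_eq hb)]
    · have := hs s hs'
      subst this
      calc _ ≤ gain (sideOf y) z σ.profit x := h4 _ (hroot ▸ hs') z hz a x ha rfl
        _ ≤ gain (sideOf y) z σ.profit y := gain_le_gain hz (hσ.mem_edges e he) (hσ.tight e he) hxy
        _ = _ := gain_eq_gain hz hσ.core _ hb.symm

theorem isRoot_iff {root : G.Comp → G.Comp} (hr : σ.IsForest root) {x : U ⊕ V}
    (hx : σ.status (G.compOf x) = .active) {C : G.Comp} :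
    σ.IsRoot (σ.component x) C ↔ C = root (G.compOf x) := by
  have hroot : σ.IsRoot (σ.component x) (root (G.compOf x)) := by
    obtain ⟨r, hrr⟩ := exists_compOf_eq (root (G.compOf x))
    constructor
    · rw [← hrr, hσ.compOf_mem_parts]
      exact (hσ.descendent_active hr (hr.descendent _ hx) hx).2.2.1 r x hrr rfl
    · intro B hB
      obtain ⟨b, rfl⟩ := exists_compOf_eq B
      rw [hσ.compOf_mem_parts] at hB
      rw [← hσ.root_eq_of_mem hr hB hx]
      exact hr.descendent _ ((hσ.status_eq_of_mem hB).trans hx)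
  refine ⟨fun h => ?_, fun h => h ▸ hroot⟩
  have hd := h.2 _ hroot.1
  obtain h | ⟨B, -, hB⟩ := Relation.ReflTransGen.cases_tail hd
  · exact h.symm
  · rw [hr.parent_root _ hx] at hB
    simp at hB

/-! ### The minimum of a component in Active -/

theorem root_attains {root : G.Comp → G.Comp} (hr : σ.IsForest root) {x : U ⊕ V}
    (hx : σ.status (G.compOf x) = .active) {s : Side}
    (hs : s ∈ σ.entrySides (root (G.compOf x))) :
    ∃ r ∈ σ.component x, G.compOf r = root (G.compOf x) ∧ sideOf r = s ∧ σ.profit r = σ.Ω := by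
  obtain ⟨r, h1, h2, h3⟩ := hr.entry_attained _ hx s hs
  refine ⟨r, ?_, h1, h2, h3⟩
  rw [← hσ.compOf_mem_parts, h1]
  exact ((hσ.isRoot_iff hr hx).2 rfl).1

theorem unsettled_of_mem {x q : U ⊕ V} (hx : σ.status (G.compOf x) = .active)
    (hq : q ∈ σ.component x) : σ.Unsettled (G.compOf q) :=
  .inr ((hσ.status_eq_of_mem hq).trans hx)

/-- Ω bounds all unsettled profits from below, and the root attains it. -/
theorem minShare_component {x : U ⊕ V} (hx : σ.status (G.compOf x) = .active) :
    G.minShare σ.profit (σ.component x) = σ.Ω := by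
  obtain ⟨root, hr⟩ := hσ.exists_forest
  obtain ⟨s, hs⟩ := hr.entry_nonempty _ hx
  obtain ⟨r, h1, -, -, h3⟩ := hσ.root_attains hr hx hs
  exact minShare_eq (fun q hq _ => hσ.le_profit q (hσ.unsettled_of_mem hx hq)) h1
    (hσ.essentialVertex (hσ.unsettled_of_mem hx h1)) h3

theorem attainsMin_iff {x : U ⊕ V} (hx : σ.status (G.compOf x) = .active) {s : Side} :
    G.AttainsMin σ.profit s (σ.component x) ↔
      ∃ q ∈ σ.component x, sideOf q = s ∧ σ.profit q = σ.Ω := by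
  rw [AttainsMin, hσ.minShare_component hx]
  exact ⟨fun ⟨q, hq, h⟩ => ⟨q, hq.1, hq.2.2, h⟩, fun ⟨q, hq, hs, h⟩ =>
    ⟨q, ⟨hq, hσ.essentialVertex (hσ.unsettled_of_mem hx hq), hs⟩, h⟩⟩

theorem attainsMin_of_mem_entrySides {root : G.Comp → G.Comp} (hr : σ.IsForest root) {x : U ⊕ V}
    (hx : σ.status (G.compOf x) = .active) {s : Side}
    (hs : s ∈ σ.entrySides (root (G.compOf x))) :
    G.AttainsMin σ.profit s (σ.component x) := by
  obtain ⟨r, h1, -, h2, h3⟩ := hσ.root_attains hr hx hs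
  exact (hσ.attainsMin_iff hx).2 ⟨r, h1, h2, h3⟩

/-- The root still attains Ω on every entry side, so a min on one side only leaves room for a single
entry side. -/
theorem mem_entrySides_iff {root : G.Comp → G.Comp} (hr : σ.IsForest root) {x : U ⊕ V}
    (hx : σ.status (G.compOf x) = .active) {s : Side}
    (hs : G.HasMinIn σ.profit s (σ.component x)) {t : Side} :
    t ∈ σ.entrySides (root (G.compOf x)) ↔ t = s := by
  have h : ∀ t ∈ σ.entrySides (root (G.compOf x)), t = s := fun t ht =>
    hs.eq_of_attainsMin (hσ.attainsMin_of_mem_entrySides hr hx ht)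
  refine ⟨h t, ?_⟩
  rintro rfl
  obtain ⟨t', ht'⟩ := hr.entry_nonempty _ hx
  exact h t' ht' ▸ ht'

theorem exists_hasMinIn {x : U ⊕ V} (hx : σ.status (G.compOf x) = .active)
    (h : ¬ G.MinOnBoth σ.profit (σ.component x)) :
    ∃ s, G.HasMinIn σ.profit s (σ.component x) := by
  obtain ⟨root, hr⟩ := hσ.exists_forest
  obtain ⟨s, hs⟩ := hr.entry_nonempty _ hx
  exact ⟨s, h, hσ.attainsMin_of_mem_entrySides hr hx hs⟩

/-! ### Gains on a tree -/

variable {z : U ⊕ V → ℝ} (hz : G.IsCore z) (hle : ∀ q, σ.Ω ≤ z q ∨ z q = σ.profit q)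
include hz hle

/-- The root of a tree, hence the whole tree, has a nonnegative gain on the entry side. -/
theorem gain_nonneg {root : G.Comp → G.Comp} (hr : σ.IsForest root) {q : U ⊕ V}
    (hq : σ.status (G.compOf q) = .active) {s : Side}
    (hs : s ∈ σ.entrySides (root (G.compOf q))) : 0 ≤ gain s z σ.profit q := by
  obtain ⟨r, -, h1, h2, h3⟩ := hσ.root_attains hr hq hs
  calc 0 ≤ gain s z σ.profit r := by
        rw [gain_of_eq z _ h2]; exact sub_nonneg.2 (le_of_profit_eq hle h3)
    _ ≤ _ := (hσ.descendent_active hr (hr.descendent _ hq) hq).2.2.2 s hs z hz r q h1 rfl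

/-- If a component has nonpositive gain on the entry side of its tree, then `z` agrees with the
current imputation on all its ancestors. -/
theorem eq_of_gain_nonpos {root : G.Comp → G.Comp} (hr : σ.IsForest root) {q : U ⊕ V}
    (hq : σ.status (G.compOf q) = .active) {s : Side}
    (hs : s ∈ σ.entrySides (root (G.compOf q))) (h : gain s z σ.profit q ≤ 0) {r : U ⊕ V}
    (hd : σ.Descendent (G.compOf r) (G.compOf q)) : z r = σ.profit r := by
  obtain ⟨h1, h2, -, h3⟩ := hσ.descendent_active hr hd hq
  exact gain_eq_zero_iff.1 (le_antisymm ((h3 s hs z hz r q rfl rfl).trans h)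
    (hσ.gain_nonneg hz hle hr h1 (h2 ▸ hs)))

end Valid
end State
end AssignmentGame

/-! ### Events preserve the invariant -/

namespace AssignmentGame
namespace State

variable {U V : Type*} {G : AssignmentGame U V} [Fintype U] [Fintype V]

theorem IsForest.descendent_mono {σ σ' : State G} (hσ : σ.Valid) {root : G.Comp → G.Comp}
    (hr : σ.IsForest root)
    (hp : ∀ A B, σ.status A = .active → σ.status B = .active → σ.parent B = some A →
      σ'.parent B = some A)
    {A B : G.Comp} (h : σ.Descendent A B) (hB : σ.status B = .active) : σ'.Descendent A B := by
  induction h with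
  | refl => exact .refl
  | @tail B C _ hBC ih =>
    have hB' := (hσ.descendent_active hr (.single hBC) hB).1
    exact (ih hB').tail (hp B C hB' hB hBC)

namespace Valid

variable {σ : State G} (hσ : σ.Valid)
include hσ

/-- No added edge touches Bin, so a component in Bin is isolated in the current tight subgraph. -/
theorem eq_iff_eq_of_bin {C : G.Comp} (hC : σ.status C = .bin) {e : U × V} (he : e ∈ σ.T) :
    G.compOf (.inl e.1) = C ↔ G.compOf (.inr e.2) = C := by
  by_cases hs : e ∈ G.startEdges
  · rw [compOf_eq hs]
  · have h := hσ.ne_bin e he hs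
    constructor
    · rintro rfl; exact absurd hC h
    · rintro rfl; exact absurd ((hσ.status_eq e he).trans hC) h

open Classical in
theorem activate {C : G.Comp} (hC : σ.status C = .bin)
    (hmin : G.minShare σ.profit C.supp = σ.Ω) :
    Valid { σ with
      status := Function.update σ.status C .active
      parent := Function.update σ.parent C none
      entrySides := Function.update σ.entrySides C {s | G.AttainsMin σ.profit s C.supp} } := by
  obtain ⟨root, hr⟩ := hσ.exists_forest
  have hne : ∀ D, σ.status D = .active → D ≠ C := by
    rintro D hD rfl; rw [hC] at hD; cases hD
  have hroot : ∀ D, σ.status D = .active → root D ≠ C := fun D hD => hne _ (hr.root_active D hD)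
  have hst : ∀ D, D ≠ C → Function.update σ.status C .active D = σ.status D :=
    fun D hD => Function.update_of_ne hD _ _
  have hun : ∀ D, (Function.update σ.status C .active D = .bin ∨
      Function.update σ.status C .active D = .active) ↔ σ.Unsettled D := fun D => by
    by_cases h : D = C
    · subst h; simp [Unsettled, hC]
    · simp [h, Unsettled]
  obtain ⟨q, hq⟩ := exists_compOf_eq C
  have hmem : ∀ D, Function.update σ.status C .active D = .active →
      D = C ∨ (D ≠ C ∧ σ.status D = .active) := fun D hD => by
    by_cases h : D = C
    · exact .inl h
    · exact .inr ⟨h, by rwa [hst D h] at hD⟩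
  refine ⟨hσ.core, hσ.nonneg, hσ.start_subset, hσ.mem_edges, hσ.tight, ?_, ?_,
    fun D hD => hσ.fundamental D ((hun D).1 hD), fun q hq => hσ.le_profit q ((hun _).1 hq),
    ⟨Function.update root C C, ?_⟩, fun D hD => hσ.rigid D fun h => hD ((hun D).2 h)⟩
  · intro e he
    have := hσ.eq_iff_eq_of_bin hC he
    by_cases h : G.compOf (.inl e.1) = C
    · rw [h, this.1 h]
    · exact (hst _ h).trans ((hσ.status_eq e he).trans (hst _ fun h' => h (this.2 h')).symm)
  · intro e he hs
    by_cases h : G.compOf (.inl e.1) = C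
    · simp [h]
    · exact fun h' => hσ.ne_bin e he hs ((hst _ h).symm.trans h')
  · refine ⟨fun D hD => ?_, fun D hD => ?_, fun D hD => ?_, fun e he hD => ?_, fun A D hD hA => ?_,
      fun D hD => ?_, fun D hD => ?_⟩ <;> dsimp only at *
    · obtain rfl | ⟨h, hD⟩ := hmem D hD
      · simp
      · simp [h, hroot D hD, hr.root_active D hD]
    · obtain rfl | ⟨h, hD⟩ := hmem D hD
      · simp
      · simp [h, hroot D hD, hr.parent_root D hD]
    · obtain rfl | ⟨h, hD⟩ := hmem D hD
      · simp only [Function.update_self]; exact .refl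
      · simp only [Function.update_of_ne h]
        refine hr.descendent_mono hσ (fun A B _ hB hAB => ?_) (hr.descendent D hD) hD
        simpa [hne B hB] using hAB
    · have := hσ.eq_iff_eq_of_bin hC he
      obtain h | ⟨h, hD⟩ := hmem _ hD
      · rw [h, this.1 h]
      · rw [Function.update_of_ne h, Function.update_of_ne fun h' => h (this.2 h')]
        exact hr.root_eq e he hD
    · obtain rfl | ⟨h, hD⟩ := hmem D hD
      · simp at hA
      · simp only [Function.update_of_ne h, Function.update_of_ne (hroot D hD)] at hA ⊢
        exact hr.parent_edge A D hD hA
    · obtain rfl | ⟨h, hD⟩ := hmem D hD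
      · simp only [Function.update_self]
        obtain ⟨r, h1, h2, h3⟩ := exists_eq_minShare σ.profit
          (show q ∈ D.supp from hq) (hσ.essentialVertex (hq ▸ .inl hC))
        exact ⟨sideOf r, r, ⟨h1, h2, rfl⟩, h3⟩
      · simp only [Function.update_of_ne h, Function.update_of_ne (hroot D hD)]
        exact hr.entry_nonempty D hD
    · obtain rfl | ⟨h, hD⟩ := hmem D hD
      · simp only [Function.update_self]
        rintro s ⟨r, h1, h2⟩
        exact ⟨r, h1.1, h1.2.2, h2.trans hmin⟩
      · simp only [Function.update_of_ne h, Function.update_of_ne (hroot D hD)]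
        exact hr.entry_attained D hD

-- The new tree edge has the required orientation: the legitimate edge leaves the tree from the side
-- opposite to its min, so it enters the child on the entry side of the root.
open Classical in
theorem grow {e : U × V} {x y : U ⊕ V} (he : σ.Legitimate e x y)
    (hy : σ.status (G.compOf y) = .bin) :
    Valid { σ with
      T := insert e σ.T
      status := Function.update σ.status (G.compOf y) .active
      parent := Function.update σ.parent (G.compOf y) (some (G.compOf x)) } := by
  obtain ⟨hsub, hxy, htight, hx, -, s, hs, hxs⟩ := he
  have hxy : Joins e x y := hxy
  obtain ⟨root, hr⟩ := hσ.exists_forest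
  generalize hB : G.compOf y = B at *
  have hne : ∀ D, σ.status D = .active → D ≠ B := by
    rintro D hD rfl; rw [hy] at hD; cases hD
  have hroot : ∀ D, σ.status D = .active → root D ≠ B := fun D hD => hne _ (hr.root_active D hD)
  have hst : ∀ D, D ≠ B → Function.update σ.status B .active D = σ.status D :=
    fun D hD => Function.update_of_ne hD _ _
  have hst' : ∀ D, σ.status D = .active → Function.update σ.status B .active D = .active :=
    fun D hD => (hst D (hne D hD)).trans hD
  have hun : ∀ D, (Function.update σ.status B .active D = .bin ∨
      Function.update σ.status B .active D = .active) ↔ σ.Unsettled D := fun D => by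
    by_cases h : D = B
    · subst h; simp [Unsettled, hy]
    · simp [h, Unsettled]
  have hmem : ∀ D, Function.update σ.status B .active D = .active →
      D = B ∨ (D ≠ B ∧ σ.status D = .active) := fun D hD => by
    by_cases h : D = B
    · exact .inl h
    · exact .inr ⟨h, by rwa [hst D h] at hD⟩
  have hends : (G.compOf (.inl e.1) = G.compOf x ∧ G.compOf (.inr e.2) = B) ∨
      (G.compOf (.inl e.1) = B ∧ G.compOf (.inr e.2) = G.compOf x) := by
    obtain ⟨rfl, rfl⟩ | ⟨rfl, rfl⟩ := hxy
    exacts [.inl ⟨rfl, hB⟩, .inr ⟨hB, rfl⟩]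
  have hmono : ∀ D, σ.status D = .active → Relation.ReflTransGen
      (fun A C => Function.update σ.parent B (some (G.compOf x)) C = some A) (root D) D := by
    intro D hD
    refine hr.descendent_mono (σ' := { σ with parent := Function.update σ.parent B _ }) hσ
      (fun A C _ hC hAC => ?_) (hr.descendent D hD) hD
    simpa [hne C hC] using hAC
  refine ⟨hσ.core, hσ.nonneg, hσ.start_subset.trans (Set.subset_insert _ _), ?_, ?_, ?_, ?_,
    fun D hD => hσ.fundamental D ((hun D).1 hD), fun q hq => hσ.le_profit q ((hun _).1 hq),
    ⟨Function.update root B (root (G.compOf x)), ?_⟩,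
    fun D hD => hσ.rigid D fun h => hD ((hun D).2 h)⟩
  · rintro f (rfl | hf)
    exacts [hsub.1, hσ.mem_edges f hf]
  · rintro f (rfl | hf)
    exacts [htight, hσ.tight f hf]
  · rintro f (rfl | hf)
    · obtain ⟨h1, h2⟩ | ⟨h1, h2⟩ := hends <;> simp [h1, h2, hst' _ hx]
    · have := hσ.eq_iff_eq_of_bin hy hf
      by_cases h : G.compOf (.inl f.1) = B
      · rw [h, this.1 h]
      · exact (hst _ h).trans ((hσ.status_eq f hf).trans (hst _ fun h' => h (this.2 h')).symm)
  · rintro f (rfl | hf) hfs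
    · obtain ⟨h1, h2⟩ | ⟨h1, h2⟩ := hends <;> simp [h1, hst' _ hx]
    · by_cases h : G.compOf (.inl f.1) = B
      · simp [h]
      · exact fun h' => hσ.ne_bin f hf hfs ((hst _ h).symm.trans h')
  · refine ⟨fun D hD => ?_, fun D hD => ?_, fun D hD => ?_, fun f hf hD => ?_, fun A D hD hA => ?_,
      fun D hD => ?_, fun D hD => ?_⟩ <;> dsimp only at *
    · obtain rfl | ⟨h, hD⟩ := hmem D hD
      · simpa using hst' _ (hr.root_active _ hx)
      · simpa [h] using hst' _ (hr.root_active _ hD)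
    · obtain rfl | ⟨h, hD⟩ := hmem D hD
      · simpa [hroot _ hx] using hr.parent_root _ hx
      · simpa [h, hroot _ hD] using hr.parent_root _ hD
    · obtain rfl | ⟨h, hD⟩ := hmem D hD
      · simp only [Function.update_self]
        exact (hmono _ hx).tail (Function.update_self _ _ _)
      · simp only [Function.update_of_ne h]
        exact hmono D hD
    · obtain rfl | hf := hf
      · obtain ⟨h1, h2⟩ | ⟨h1, h2⟩ := hends <;> simp [h1, h2, hne _ hx]
      · have := hσ.eq_iff_eq_of_bin hy hf
        obtain h | ⟨h, hD⟩ := hmem _ hD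
        · rw [h, this.1 h]
        · rw [Function.update_of_ne h, Function.update_of_ne fun h' => h (this.2 h')]
          exact hr.root_eq f hf hD
    · obtain rfl | ⟨h, hD⟩ := hmem D hD
      · simp only [Function.update_self, Option.some.injEq] at hA ⊢
        refine ⟨e, .inl rfl, x, y, hxy, hA, hB, fun t ht => ?_⟩
        rw [(hσ.mem_entrySides_iff hr hx hs).1 ht, hxy.sideOf_eq, hxs.2.2, s.opp_opp]
      · simp only [Function.update_of_ne h] at hA ⊢
        obtain ⟨f, hf, h'⟩ := hr.parent_edge A D hD hA
        exact ⟨f, .inr hf, h'⟩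
    · obtain rfl | ⟨h, hD⟩ := hmem D hD
      · simpa using hr.entry_nonempty _ hx
      · simpa [h] using hr.entry_nonempty D hD
    · obtain rfl | ⟨h, hD⟩ := hmem D hD
      · simpa using hr.entry_attained _ hx
      · simpa [h] using hr.entry_attained D hD

/-- The common core of all settling events. Since R is a union of components, trees outside it
survive intact. The only obligation that depends on the event is `hnew`: the newly settled
components are rigid at threshold Ω. -/
theorem settle {T' : Set (U × V)} {R M : Set G.Comp} {st : Status}
    (hst : st ≠ .bin ∧ st ≠ .active) (hT : σ.T ⊆ T')
    (hT' : ∀ f ∈ T', f ∉ σ.T → f ∈ G.edges ∧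
      σ.profit (.inl f.1) + σ.profit (.inr f.2) = G.weight f ∧
      G.compOf (.inl f.1) ∈ M ∧ G.compOf (.inr f.2) ∈ M)
    (hMR : M ⊆ R)
    (hR : ∀ f ∈ σ.T, G.compOf (.inl f.1) ∈ R ↔ G.compOf (.inr f.2) ∈ R)
    (hold : ∀ C ∈ R, ¬ σ.Unsettled C → C ∈ M)
    (hnew : ∀ z, G.IsCore z → (∀ q, σ.Ω ≤ z q ∨ z q = σ.profit q) →
      ∀ q, G.compOf q ∈ M → σ.Unsettled (G.compOf q) → z q = σ.profit q) :
    (σ.settle T' R M st).Valid := by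
  classical
  obtain ⟨root, hr⟩ := hσ.exists_forest
  have hM : ∀ C ∈ M, (σ.settle T' R M st).status C = st := fun C hC => by
    simp [State.settle, hMR hC, hC]
  have hRM : ∀ C ∈ R, C ∉ M → (σ.settle T' R M st).status C = .bin := fun C hC hC' => by
    simp [State.settle, hC, hC']
  have hRc : ∀ C, C ∉ R → (σ.settle T' R M st).status C = σ.status C := fun C hC => by
    simp [State.settle, hC]
  have hun : ∀ C, (σ.settle T' R M st).Unsettled C → σ.Unsettled C ∧ C ∉ M := fun C hC => by
    have h : C ∉ M := fun h => by
      rw [Unsettled, hM C h] at hC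
      exact hC.elim hst.1 hst.2
    refine ⟨?_, h⟩
    by_cases hCR : C ∈ R
    · by_contra h'
      exact h (hold C hCR h')
    · rwa [Unsettled, hRc C hCR] at hC
  have hact : ∀ C, (σ.settle T' R M st).status C = .active → C ∉ R ∧ σ.status C = .active :=
    fun C hC => by
      have h : C ∉ R := fun h => by
        by_cases h' : C ∈ M
        · exact hst.2 ((hM C h').symm.trans hC)
        · have := (hRM C h h').symm.trans hC
          cases this
      exact ⟨h, (hRc C h).symm.trans hC⟩
  have hTmem : ∀ f ∈ (σ.settle T' R M st).T, f ∉ σ.T → f ∈ G.edges ∧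
      σ.profit (.inl f.1) + σ.profit (.inr f.2) = G.weight f ∧
      G.compOf (.inl f.1) ∈ M ∧ G.compOf (.inr f.2) ∈ M := fun f hf => hT' f hf.1
  have hdich : ∀ f ∈ (σ.settle T' R M st).T, f ∉ G.startEdges →
      (G.compOf (.inl f.1) ∈ M ∧ G.compOf (.inr f.2) ∈ M) ∨
      (f ∈ σ.T ∧ G.compOf (.inl f.1) ∉ R ∧ G.compOf (.inr f.2) ∉ R) := fun f hf hfs => by
    by_cases h : f ∈ σ.T
    · obtain ⟨h1, h2⟩ := hf.2.resolve_left hfs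
      by_cases h3 : G.compOf (.inl f.1) ∈ R
      · have h4 := (hR f h).1 h3
        exact .inl ⟨by_contra fun h' => h1 ⟨h3, h'⟩, by_contra fun h' => h2 ⟨h4, h'⟩⟩
      · exact .inr ⟨h, h3, fun h' => h3 ((hR f h).2 h')⟩
    · exact .inl (hTmem f hf h).2.2
  -- trees outside of `R` are not affected
  have hup : ∀ A B, B ∉ R → σ.status B = .active → σ.parent B = some A → A ∉ R := by
    intro A B hB hBa hAB hA
    obtain ⟨f, hf, x, y, hxy, rfl, rfl, -⟩ := hr.parent_edge A B hBa hAB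
    obtain ⟨rfl, rfl⟩ | ⟨rfl, rfl⟩ := hxy
    exacts [hB ((hR f hf).1 hA), hB ((hR f hf).2 hA)]
  have hpar : ∀ C, C ∉ R → (σ.settle T' R M st).parent C = σ.parent C := fun C hC => by
    simp [State.settle, hC]
  have hdesc : ∀ A B, σ.Descendent A B → B ∉ R → σ.status B = .active →
      A ∉ R ∧ (σ.settle T' R M st).Descendent A B := by
    intro A B h
    induction h with
    | refl => exact fun h _ => ⟨h, .refl⟩
    | @tail B C _ hBC ih =>
      intro hC hCa
      have hB := hup B C hC hCa hBC
      obtain ⟨h1, h2⟩ := ih hB (hσ.descendent_active hr (.single hBC) hCa).1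
      exact ⟨h1, h2.tail ((hpar C hC).trans hBC)⟩
  have hroot : ∀ C, C ∉ R → σ.status C = .active → root C ∉ R :=
    fun C hC hCa => (hdesc _ _ (hr.descendent C hCa) hC hCa).1
  refine ⟨hσ.core, hσ.nonneg, fun f hf => ⟨hT (hσ.start_subset hf), .inl hf⟩, fun f hf => ?_,
    fun f hf => ?_, fun f hf => ?_, fun f hf hfs => ?_, fun C hC => hσ.fundamental C (hun C hC).1,
    fun q hq => hσ.le_profit q (hun _ hq).1, ⟨root, ?_⟩, fun C hC => ?_⟩
  · by_cases h : f ∈ σ.T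
    exacts [hσ.mem_edges f h, (hTmem f hf h).1]
  · by_cases h : f ∈ σ.T
    exacts [hσ.tight f h, (hTmem f hf h).2.1]
  · by_cases hfs : f ∈ G.startEdges
    · rw [compOf_eq hfs]
    · obtain ⟨h1, h2⟩ | ⟨h, h1, h2⟩ := hdich f hf hfs
      · rw [hM _ h1, hM _ h2]
      · rw [hRc _ h1, hRc _ h2, hσ.status_eq f h]
  · obtain ⟨h1, h2⟩ | ⟨h, h1, h2⟩ := hdich f hf hfs
    · rw [hM _ h1]; exact hst.1
    · rw [hRc _ h1]; exact hσ.ne_bin f h hfs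
  · refine ⟨fun C hC => ?_, fun C hC => ?_, fun C hC => ?_, fun f hf hC => ?_, fun A C hC hA => ?_,
      fun C hC => hr.entry_nonempty C (hact C hC).2,
      fun C hC => hr.entry_attained C (hact C hC).2⟩
    · obtain ⟨h1, h2⟩ := hact C hC
      rw [hRc _ (hroot C h1 h2)]
      exact hr.root_active C h2
    · obtain ⟨h1, h2⟩ := hact C hC
      rw [hpar _ (hroot C h1 h2)]
      exact hr.parent_root C h2
    · obtain ⟨h1, h2⟩ := hact C hC
      exact (hdesc _ _ (hr.descendent C h2) h1 h2).2
    · obtain ⟨h1, h2⟩ := hact _ hC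
      refine hr.root_eq f (by_contra fun h => ?_) h2
      exact h1 (hMR (hTmem f hf h).2.2.1)
    · obtain ⟨h1, h2⟩ := hact C hC
      rw [hpar C h1] at hA
      have h3 := hup A C h1 h2 hA
      obtain ⟨f, hf, x, y, hxy, hx, hy, h⟩ := hr.parent_edge A C h2 hA
      refine ⟨f, ⟨hT hf, .inr ?_⟩, x, y, hxy, hx, hy, h⟩
      subst hx hy
      obtain ⟨rfl, rfl⟩ | ⟨rfl, rfl⟩ := hxy
      exacts [⟨fun h => h3 h.1, fun h => h1 h.1⟩, ⟨fun h => h1 h.1, fun h => h3 h.1⟩]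
  · by_cases h : σ.Unsettled C
    · have hCM : C ∈ M := by
        by_contra hCM
        by_cases hCR : C ∈ R
        · exact hC (.inl (hRM C hCR hCM))
        · exact hC (by rwa [Unsettled, hRc C hCR])
      -- The threshold of a component is the time at which it is settled, when its profits are still
      -- at least Ω.
      refine ⟨σ.Ω, le_rfl, fun q hq _ => hσ.le_profit q (hq ▸ h), fun z hz hle q hq => ?_⟩
      exact hnew z hz hle q (hq ▸ hCM) (hq ▸ h)
    · exact hσ.rigid C h

end Valid
end State
end AssignmentGame

/-! ### Every event decreases a potential -/

namespace AssignmentGame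
namespace State

variable {U V : Type*} {G : AssignmentGame U V}

/-- A natural number that every event decreases. -/
noncomputable def potential (σ : State G) : ℕ :=
  {C | σ.Unsettled C}.ncard * (Nat.card G.Comp + 1) + {C | σ.status C = .bin}.ncard

theorem unsettled_settle {σ : State G} {T' : Set (U × V)} {R M : Set G.Comp} {st : Status}
    (hst : st ≠ .bin ∧ st ≠ .active) (hMR : M ⊆ R) (hold : ∀ C ∈ R, ¬ σ.Unsettled C → C ∈ M)
    {C : G.Comp} (hC : (σ.settle T' R M st).Unsettled C) : σ.Unsettled C ∧ C ∉ M := by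
  have h : C ∉ M := fun h => by
    simp only [Unsettled, State.settle, hMR h, h, if_true] at hC
    exact hC.elim hst.1 hst.2
  refine ⟨?_, h⟩
  by_cases hCR : C ∈ R
  · by_contra h'
    exact h (hold C hCR h')
  · simpa only [Unsettled, State.settle, hCR, if_false] using hC

/-- Both ends of a new edge lie in a set that contains the components of its two ends. -/
theorem Legitimate.insert_spec {σ : State G} {e : U × V} {x y : U ⊕ V} (he : σ.Legitimate e x y) {M : Set G.Comp}
    (hx : G.compOf x ∈ M) (hy : G.compOf y ∈ M) : ∀ f ∈ insert e σ.T, f ∉ σ.T → f ∈ G.edges ∧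
      σ.profit (.inl f.1) + σ.profit (.inr f.2) = G.weight f ∧
      G.compOf (.inl f.1) ∈ M ∧ G.compOf (.inr f.2) ∈ M := by
  rintro f (rfl | hf) hf'
  · refine ⟨he.1.1, he.2.2.1, ?_⟩
    obtain ⟨rfl, rfl⟩ | ⟨rfl, rfl⟩ := he.2.1
    exacts [⟨hx, hy⟩, ⟨hy, hx⟩]
  · exact absurd hf hf'

variable [Fintype U] [Fintype V]

/-- What every event guarantees. -/
structure Improves (σ σ' : State G) : Prop where
  valid : σ'.Valid
  profit_eq : σ'.profit = σ.profit
  Ω_eq : σ'.Ω = σ.Ω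
  unsettled : ∀ C, σ'.Unsettled C → σ.Unsettled C
  potential_lt : σ'.potential < σ.potential

open Classical in
theorem potential_update_lt (σ : State G) {C : G.Comp} (hC : σ.status C = .bin)
    {σ' : State G} (h : σ'.status = Function.update σ.status C .active) :
    (∀ D, σ'.Unsettled D → σ.Unsettled D) ∧ σ'.potential < σ.potential := by
  have hun : ∀ D, σ'.Unsettled D ↔ σ.Unsettled D := fun D => by
    by_cases hD : D = C
    · subst hD; simp [Unsettled, h, hC]
    · simp [Unsettled, h, hD]
  refine ⟨fun D => (hun D).1, ?_⟩
  simp only [potential, hun]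
  refine Nat.add_lt_add_left (Set.ncard_lt_ncard ⟨fun D hD => ?_, fun hsub => ?_⟩
    (Set.toFinite _)) _
  · by_cases hDC : D = C
    · subst hDC; exact hC
    · simpa [h, hDC] using hD
  · have := hsub (show C ∈ {C | σ.status C = .bin} from hC)
    simp [h] at this

namespace Valid

variable {σ : State G} (hσ : σ.Valid)
include hσ

theorem improves_settle {T' : Set (U × V)} {R M : Set G.Comp} {st : Status}
    (hst : st ≠ .bin ∧ st ≠ .active) (hT : σ.T ⊆ T')
    (hT' : ∀ f ∈ T', f ∉ σ.T → f ∈ G.edges ∧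
      σ.profit (.inl f.1) + σ.profit (.inr f.2) = G.weight f ∧
      G.compOf (.inl f.1) ∈ M ∧ G.compOf (.inr f.2) ∈ M)
    (hMR : M ⊆ R)
    (hR : ∀ f ∈ σ.T, G.compOf (.inl f.1) ∈ R ↔ G.compOf (.inr f.2) ∈ R)
    (hold : ∀ C ∈ R, ¬ σ.Unsettled C → C ∈ M)
    (hnew : ∀ z, G.IsCore z → (∀ q, σ.Ω ≤ z q ∨ z q = σ.profit q) →
      ∀ q, G.compOf q ∈ M → σ.Unsettled (G.compOf q) → z q = σ.profit q)
    (hne : ∃ C ∈ M, σ.Unsettled C) :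
    σ.Improves (σ.settle T' R M st) := by
  refine ⟨hσ.settle hst hT hT' hMR hR hold hnew, rfl, rfl,
    fun C hC => (unsettled_settle hst hMR hold hC).1, ?_⟩
  obtain ⟨C, hC, hCu⟩ := hne
  have h1 : {C | (σ.settle T' R M st).Unsettled C}.ncard < {C | σ.Unsettled C}.ncard :=
    Set.ncard_lt_ncard ⟨fun D hD => (unsettled_settle hst hMR hold hD).1,
      fun hsub => (unsettled_settle hst hMR hold (hsub hCu)).2 hC⟩ (Set.toFinite _)
  -- Settling may refill Bin, but only up to the number of components. The weight given to unsettled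
  -- components in `potential` exceeds this.
  have h2 : {C | (σ.settle T' R M st).status C = .bin}.ncard ≤ Nat.card G.Comp := by
    rw [← Set.ncard_univ]
    exact Set.ncard_le_ncard (Set.subset_univ _) (Set.toFinite _)
  unfold potential
  nlinarith

theorem mem_parts_of_descendent {x : U ⊕ V} (hx : σ.status (G.compOf x) = .active) {A B : G.Comp}
    (hB : B ∈ G.parts (σ.component x)) (h : σ.Descendent A B) :
    A ∈ G.parts (σ.component x) := by
  obtain ⟨root, hr⟩ := hσ.exists_forest
  obtain ⟨a, rfl⟩ := exists_compOf_eq A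
  obtain ⟨b, rfl⟩ := exists_compOf_eq B
  have hb := hσ.compOf_mem_parts.1 hB
  rw [hσ.compOf_mem_parts, ← component_eq hb]
  exact (hσ.descendent_active hr h ((hσ.status_eq_of_mem hb).trans hx)).2.2.1 a b rfl rfl

theorem rootPath_subset {x : U ⊕ V} (hx : σ.status (G.compOf x) = .active) :
    σ.rootPath (σ.component x) (G.compOf x) ⊆ G.parts (σ.component x) :=
  fun _ ⟨_, _, h⟩ => hσ.mem_parts_of_descendent hx (hσ.compOf_mem_parts.2 rfl) h.2

theorem compOf_mem_rootPath {x : U ⊕ V} (hx : σ.status (G.compOf x) = .active) :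
    G.compOf x ∈ σ.rootPath (σ.component x) (G.compOf x) := by
  obtain ⟨root, hr⟩ := hσ.exists_forest
  exact ⟨_, (hσ.isRoot_iff hr hx).2 rfl, hr.descendent _ hx, .refl⟩

theorem unsettled_of_mem_parts {x : U ⊕ V} (hx : σ.status (G.compOf x) = .active) {C : G.Comp}
    (hC : C ∈ G.parts (σ.component x)) : σ.Unsettled C :=
  .inr ((hσ.status_eq_of_mem_parts hC).trans hx)

theorem minSub1_subset {x : U ⊕ V} (hx : σ.status (G.compOf x) = .active) :
    σ.minSub1 (σ.component x) ⊆ G.parts (σ.component x) := by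
  rintro C ⟨C₀, h0, rfl | ⟨B, hB, hC⟩⟩
  · exact h0.1
  · exact hσ.mem_parts_of_descendent hx hB.1 hC.2

/-- A vertex at Ω on the side opposite to an entry side has nonpositive gain, while its ancestors
have nonnegative gains that are no larger. All of them vanish on the path to the root. -/
theorem eq_of_mem_minSub1 {x : U ⊕ V} (hx : σ.status (G.compOf x) = .active)
    (hboth : G.MinOnBoth σ.profit (σ.component x)) {z : U ⊕ V → ℝ} (hz : G.IsCore z)
    (hle : ∀ q, σ.Ω ≤ z q ∨ z q = σ.profit q) {q : U ⊕ V}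
    (hq : G.compOf q ∈ σ.minSub1 (σ.component x)) : z q = σ.profit q := by
  obtain ⟨root, hr⟩ := hσ.exists_forest
  -- a vertex on the opposite side which attains the minimum blocks its ancestors
  have key : ∀ s ∈ σ.entrySides (root (G.compOf x)), ∀ b ∈ σ.component x, sideOf b = s.opp →
      σ.profit b = σ.Ω → σ.Descendent (G.compOf q) (G.compOf b) → z q = σ.profit q := by
    intro s hs b hb hsb hΩ hd
    have hba := (hσ.status_eq_of_mem hb).trans hx
    refine hσ.eq_of_gain_nonpos hz hle hr hba (s := s)
      (hσ.root_eq_of_mem hr hb hx ▸ hs) ?_ hd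
    rw [gain_of_eq_opp z _ hsb]
    exact sub_nonpos.2 (le_of_profit_eq hle hΩ)
  obtain ⟨C₀, h0, h⟩ := hq
  obtain rfl := (hσ.isRoot_iff hr hx).1 h0
  obtain h | ⟨B, ⟨hB, -, hmin, s, hs, b, hb, hbm⟩, h⟩ := h
  -- The root is the ancestor of whichever vertex attains the min on the opposite side, wherever
  -- that vertex lies in the tree.
  · obtain ⟨s, hs⟩ := hr.entry_nonempty _ hx
    have hopp : G.AttainsMin σ.profit s.opp (σ.component x) := by
      cases s
      exacts [hboth.2, hboth.1]
    obtain ⟨b, hb, hsb, hΩ⟩ := (hσ.attainsMin_iff hx).1 hopp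
    exact key s hs b hb hsb hΩ (h ▸ h0.2 _ (hσ.compOf_mem_parts.2 hb))
  · obtain ⟨r, hrx, hrr, -, hrΩ⟩ := hσ.root_attains hr hx hs
    have hbB : G.compOf b = B := hb.1
    subst hbB
    have hbx := hσ.compOf_mem_parts.1 hB
    refine key s hs b hbx hb.2.2 (le_antisymm ?_ (hσ.le_profit b (hσ.unsettled_of_mem hx hbx))) h.2
    rw [hbm, hmin, ← hrΩ]
    exact minShare_le _ (show r ∈ (root (G.compOf x)).supp from hrr)
      (hσ.essentialVertex (hσ.unsettled_of_mem hx hrx))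

theorem repair {x : U ⊕ V} (hx : σ.status (G.compOf x) = .active)
    (hboth : G.MinOnBoth σ.profit (σ.component x)) :
    σ.Improves (σ.settle σ.T (G.parts (σ.component x)) (σ.minSub1 (σ.component x)) .repaired) := by
  refine hσ.improves_settle (by simp) subset_rfl (fun f hf hf' => absurd hf hf')
    (hσ.minSub1_subset hx) (fun f hf => hσ.parts_closed hf)
    (fun C hC h => absurd (hσ.unsettled_of_mem_parts hx hC) h)
    (fun z hz hle q hq _ => hσ.eq_of_mem_minSub1 hx hboth hz hle hq) ?_
  obtain ⟨root, hr⟩ := hσ.exists_forest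
  exact ⟨_, ⟨_, (hσ.isRoot_iff hr hx).2 rfl, .inl rfl⟩, .inr (hr.root_active _ hx)⟩

/-- The two ends of a legitimate edge. -/
theorem legitimate_spec {e : U × V} {x y : U ⊕ V} (he : σ.Legitimate e x y)
    {root : G.Comp → G.Comp} (hr : σ.IsForest root) {z : U ⊕ V → ℝ} (hz : G.IsCore z)
    (hle : ∀ q, σ.Ω ≤ z q ∨ z q = σ.profit q) :
    sideOf y ∈ σ.entrySides (root (G.compOf x)) ∧
      G.HasMinIn σ.profit (sideOf y) (σ.component x) ∧
      0 ≤ gain (sideOf y) z σ.profit x ∧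
      gain (sideOf y) z σ.profit x ≤ gain (sideOf y) z σ.profit y := by
  obtain ⟨hsub, hxy, htight, hx, -, s, hs, hxs⟩ := he
  have hxy : Joins e x y := hxy
  have hy : sideOf y = s := by rw [hxy.sideOf_eq, hxs.2.2, s.opp_opp]
  subst hy
  have hmem := (hσ.mem_entrySides_iff hr hx hs).2 rfl
  exact ⟨hmem, hs, hσ.gain_nonneg hz hle hr hx hmem, gain_le_gain hz hsub.1 htight hxy⟩

theorem parts_union_closed {x y : U ⊕ V} {f : U × V} (hf : f ∈ σ.T) :
    G.compOf (.inl f.1) ∈ G.parts (σ.component x) ∪ G.parts (σ.component y) ↔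
      G.compOf (.inr f.2) ∈ G.parts (σ.component x) ∪ G.parts (σ.component y) :=
  or_congr (hσ.parts_closed hf) (hσ.parts_closed hf)

/-- The two trees have opposite entry sides. The gain at y is nonnegative by comparison with x and
nonpositive by its own tree, so it is zero, and both paths to the roots are squeezed. -/
theorem meet {e : U × V} {x y : U ⊕ V} (he : σ.Legitimate e x y)
    (hy : σ.status (G.compOf y) = .active)
    (hopp : ∃ s : Side, G.HasMinIn σ.profit s (σ.component x) ∧
      G.HasMinIn σ.profit s.opp (σ.component y)) :
    σ.Improves (σ.settle (insert e σ.T) (G.parts (σ.component x) ∪ G.parts (σ.component y))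
      (σ.minSub2 x y) .repaired) := by
  have hx := he.2.2.2.1
  refine hσ.improves_settle (by simp) (Set.subset_insert _ _)
    (he.insert_spec (.inl (hσ.compOf_mem_rootPath hx)) (.inr (hσ.compOf_mem_rootPath hy)))
    (Set.union_subset_union (hσ.rootPath_subset hx) (hσ.rootPath_subset hy))
    (fun f hf => hσ.parts_union_closed hf) ?_ ?_
    ⟨_, .inl (hσ.compOf_mem_rootPath hx), .inr hx⟩
  · rintro C (hC | hC) h
    exacts [absurd (hσ.unsettled_of_mem_parts hx hC) h, absurd (hσ.unsettled_of_mem_parts hy hC) h]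
  · intro z hz hle q hq _
    obtain ⟨root, hr⟩ := hσ.exists_forest
    obtain ⟨h1, h2, h3, h4⟩ := hσ.legitimate_spec he hr hz hle
    obtain ⟨s, hs, hs'⟩ := hopp
    obtain rfl := h2.eq_of_attainsMin hs.2
    have h5 := (hσ.mem_entrySides_iff hr hy hs').2 rfl
    have h6 := hσ.gain_nonneg hz hle hr hy h5
    have h7 := gain_opp (sideOf y) z σ.profit y
    obtain ⟨C₀, -, -, hq⟩ | ⟨C₀, -, -, hq⟩ := hq
    · exact hσ.eq_of_gain_nonpos hz hle hr hx h1 (by linarith) hq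
    · exact hσ.eq_of_gain_nonpos hz hle hr hy h5 (by linarith) hq

/-- Rigidity of the settled end, whose threshold is at most Ω, makes its gain zero; this bounds the
gains on the path from the root from above. Frozen and Fully-Repaired play the same role here. -/
theorem attach {e : U × V} {x y : U ⊕ V} (he : σ.Legitimate e x y)
    (hy : ¬ σ.Unsettled (G.compOf y)) {st : Status} (hst : st ≠ .bin ∧ st ≠ .active) :
    σ.Improves (σ.settle (insert e σ.T) (G.parts (σ.component x) ∪ G.parts (σ.component y))
      (σ.minSub3 x y) st) := by
  have hx := he.2.2.2.1
  refine hσ.improves_settle hst (Set.subset_insert _ _)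
    (he.insert_spec (.inl (hσ.compOf_mem_rootPath hx)) (.inr (hσ.compOf_mem_parts.2 rfl)))
    (Set.union_subset_union (hσ.rootPath_subset hx) subset_rfl)
    (fun f hf => hσ.parts_union_closed hf) ?_ ?_
    ⟨_, .inl (hσ.compOf_mem_rootPath hx), .inr hx⟩
  · rintro C (hC | hC) h
    exacts [absurd (hσ.unsettled_of_mem_parts hx hC) h, .inr hC]
  · intro z hz hle q hq hqu
    obtain ⟨root, hr⟩ := hσ.exists_forest
    obtain ⟨h1, h2, h3, h4⟩ := hσ.legitimate_spec he hr hz hle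
    obtain ⟨C₀, -, -, hq⟩ | hq := hq
    · obtain ⟨θ, hθ, -, hrig⟩ := hσ.rigid _ hy
      have h5 := hrig z hz (fun q => (hle q).imp_left hθ.trans) y rfl
      rw [gain_eq_zero_iff.2 h5] at h4
      exact hσ.eq_of_gain_nonpos hz hle hr hx h1 h4 hq
    · refine absurd ?_ hy
      rwa [Unsettled, ← hσ.status_eq_of_mem_parts hq]

theorem event {σ' : State G} (h : Event σ σ') : σ.Improves σ' := by
  cases h with
  | activate C hC hmin =>
    exact ⟨hσ.activate hC hmin, rfl, rfl, (potential_update_lt σ hC rfl).1,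
      (potential_update_lt σ hC rfl).2⟩
  | repair x hx hboth => exact hσ.repair hx hboth
  | grow e x y he hy =>
    exact ⟨hσ.grow he hy, rfl, rfl, (potential_update_lt σ hy rfl).1,
      (potential_update_lt σ hy rfl).2⟩
  | meet e x y he hy hopp => exact hσ.meet he hy hopp
  | freeze e x y he hy => exact hσ.attach he (by simp [Unsettled, hy]) (by simp)
  | attach e x y he hy => exact hσ.attach he (by simp [Unsettled, hy]) (by simp)

end Valid
end State
end AssignmentGame

/-! ### Raising Ω between events -/

namespace AssignmentGame
namespace State

variable {U V : Type*} {G : AssignmentGame U V}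

/-! ### Rates of change -/

theorem rate_eq_zero {σ : State G} {q : U ⊕ V} (h : σ.status (G.compOf q) ≠ .active) :
    σ.rate q = 0 := by
  rw [rate, if_neg fun h' => h h'.1]

theorem rate_eq_zero_of_not_essentialVertex {σ : State G} {q : U ⊕ V}
    (h : ¬ G.EssentialVertex q) : σ.rate q = 0 := by
  rw [rate, if_neg fun h' => h h'.2]

theorem rate_eq_zero_of_minOnBoth {σ : State G} {q : U ⊕ V}
    (h : G.MinOnBoth σ.profit (σ.component q)) : σ.rate q = 0 := by
  rw [rate, if_neg fun h' : G.HasMinIn _ _ _ => h'.1 h,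
    if_neg fun h' : G.HasMinIn _ _ _ => h'.1 h, ite_self]

theorem rate_le_one (σ : State G) (q : U ⊕ V) : σ.rate q ≤ 1 := by
  unfold rate; split_ifs <;> norm_num

theorem rate_cases (σ : State G) (q : U ⊕ V) : σ.rate q = 1 ∨ σ.rate q = 0 ∨ σ.rate q = -1 := by
  unfold rate; split_ifs <;> simp

theorem advance_zero (σ : State G) : σ.advance 0 = σ := by
  simp [State.advance]

theorem NextEventAfter.not_eventDue {σ : State G} {δ : ℝ} (h : σ.NextEventAfter δ) :
    ¬ σ.EventDue := by
  have := h.2.2.2 0 le_rfl h.2.1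
  rwa [advance_zero] at this

/-- The first time at which one of finitely many decreasing affine functions vanishes. -/
theorem exists_first_zero {ι : Type*} [Finite ι] (a b : ι → ℝ) (hab : ∀ i, 0 < b i → 0 < a i)
    (hb : ∃ i, 0 < b i) : ∃ δ > 0, (∀ t ≤ δ, ∀ i, 0 < b i → t * b i ≤ a i) ∧
      (∀ t < δ, ∀ i, 0 < b i → t * b i < a i) ∧ ∃ i, 0 < b i ∧ δ * b i = a i := by
  obtain ⟨i, hi, hmin⟩ := Set.exists_min_image {i | 0 < b i} (fun i => a i / b i)
    (Set.toFinite _) hb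
  refine ⟨a i / b i, div_pos (hab i hi) hi, fun t ht j hj => ?_, fun t ht j hj => ?_, i, hi,
    div_mul_cancel₀ _ (ne_of_gt hi)⟩
  · exact (le_div_iff₀ hj).1 (ht.trans (hmin j hj))
  · exact (lt_div_iff₀ hj).1 (ht.trans_le (hmin j hj))

variable [Fintype U] [Fintype V]

/-- All inequalities that the invariant demands are strict, unless they stay equalities when `Ω`
is raised. -/
structure Quiet (σ : State G) : Prop where
  lt_profit : ∀ q, σ.Unsettled (G.compOf q) → σ.rate q ≠ 1 → σ.Ω < σ.profit q
  weight_lt : ∀ e ∈ G.edges, σ.rate (.inl e.1) + σ.rate (.inr e.2) < 0 →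
    G.weight e < σ.profit (.inl e.1) + σ.profit (.inr e.2)

/-- The inequalities that the invariant demands hold after raising `Ω` by `t`. -/
structure Safe (σ : State G) (t : ℝ) : Prop where
  le_profit : ∀ q, σ.Unsettled (G.compOf q) → σ.Ω + t ≤ σ.profit q + t * σ.rate q
  weight_le : ∀ e ∈ G.edges, G.weight e ≤
    (σ.profit (.inl e.1) + t * σ.rate (.inl e.1)) + (σ.profit (.inr e.2) + t * σ.rate (.inr e.2))

/-- The inequalities that the invariant demands hold strictly after raising `Ω` by `t`, unless they
stay equalities. -/
structure StrictlySafe (σ : State G) (t : ℝ) : Prop where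
  lt_profit : ∀ q, σ.Unsettled (G.compOf q) → σ.rate q ≠ 1 →
    σ.Ω + t < σ.profit q + t * σ.rate q
  weight_lt : ∀ e ∈ G.edges, σ.rate (.inl e.1) + σ.rate (.inr e.2) < 0 → G.weight e <
    (σ.profit (.inl e.1) + t * σ.rate (.inl e.1)) + (σ.profit (.inr e.2) + t * σ.rate (.inr e.2))

namespace Valid

variable {σ : State G} (hσ : σ.Valid)
include hσ

theorem rate_eq_one {x q : U ⊕ V} (hx : σ.status (G.compOf x) = .active)
    (hq : q ∈ σ.component x) {s : Side} (hs : G.HasMinIn σ.profit s (σ.component x))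
    (h : sideOf q = s) : σ.rate q = 1 := by
  have hqa := (hσ.status_eq_of_mem hq).trans hx
  rw [rate, if_pos ⟨hqa, hσ.essentialVertex (.inr hqa)⟩, component_eq hq, if_pos (h ▸ hs)]

theorem rate_eq_neg_one {x q : U ⊕ V} (hx : σ.status (G.compOf x) = .active)
    (hq : q ∈ σ.component x) {s : Side} (hs : G.HasMinIn σ.profit s (σ.component x))
    (h : sideOf q = s.opp) : σ.rate q = -1 := by
  have hqa := (hσ.status_eq_of_mem hq).trans hx
  rw [rate, if_pos ⟨hqa, hσ.essentialVertex (.inr hqa)⟩, component_eq hq, h, if_neg fun h' =>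
    s.opp_ne (hs.eq_of_attainsMin h'.2), s.opp_opp, if_pos hs]

theorem rate_add {e : U × V} (he : e ∈ σ.T) :
    σ.rate (.inl e.1) + σ.rate (.inr e.2) = 0 := by
  have hm : Sum.inr e.2 ∈ σ.component (.inl e.1) := mem_component_of_joins (joins_self e) he
  have hl : Sum.inl e.1 ∈ σ.component (.inl e.1) := σ.mem_component_self _
  by_cases ha : σ.status (G.compOf (.inl e.1)) = .active
  · by_cases hb : G.MinOnBoth σ.profit (σ.component (.inl e.1))
    · rw [rate_eq_zero_of_minOnBoth hb, rate_eq_zero_of_minOnBoth (by rwa [component_eq hm]),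
        add_zero]
    · obtain ⟨s, hs⟩ := hσ.exists_hasMinIn ha hb
      cases s
      · rw [hσ.rate_eq_one ha hl hs rfl, hσ.rate_eq_neg_one ha hm hs rfl]; norm_num
      · rw [hσ.rate_eq_neg_one ha hl hs rfl, hσ.rate_eq_one ha hm hs rfl]; norm_num
  · rw [rate_eq_zero ha, rate_eq_zero (by rwa [← hσ.status_eq e he]), add_zero]

/-- At a legitimate edge the end `x` is decreasing. -/
theorem rate_of_legitimate {e : U × V} {x y : U ⊕ V} (he : σ.Legitimate e x y) :
    σ.rate x = -1 := by
  obtain ⟨-, -, -, hx, -, s, hs, hxs⟩ := he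
  exact hσ.rate_eq_neg_one hx (σ.mem_component_self x) hs hxs.2.2

/-! ### When an event is due -/

/-- With min on one side only, a vertex at Ω lies on the rising side. -/
theorem minOnBoth_of_rate {q : U ⊕ V} (hq : σ.status (G.compOf q) = .active)
    (h : σ.rate q ≠ 1) (hΩ : σ.profit q = σ.Ω) :
    G.MinOnBoth σ.profit (σ.component q) := by
  by_contra hb
  have hm := σ.mem_component_self q
  obtain ⟨s, hs⟩ := hσ.exists_hasMinIn hq hb
  have := hs.eq_of_attainsMin ((hσ.attainsMin_iff hq (s := sideOf q)).2 ⟨q, hm, rfl, hΩ⟩)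
  exact h (hσ.rate_eq_one hq hm hs this)

theorem minShare_supp {q : U ⊕ V} (hq : σ.Unsettled (G.compOf q)) (hΩ : σ.profit q = σ.Ω) :
    G.minShare σ.profit (G.compOf q).supp = σ.Ω :=
  minShare_eq (fun r hr _ => hσ.le_profit r (show σ.Unsettled (G.compOf r) from
    (mem_supp_iff.1 hr).symm ▸ hq)) (show q ∈ (G.compOf q).supp from rfl) (hσ.essentialVertex hq) hΩ

/-- A tight edge about to be violated is legitimate: inside the component of x, the end y would be
rising. The status of y then selects the event. If y is in Active, either its component has min on
both sides, or its min is opposite to that of x because y does not rise. -/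
theorem eventDue_of_tight {e : U × V} (he : e ∈ G.edges) {x y : U ⊕ V} (hxy : Joins e x y)
    (ht : σ.profit (.inl e.1) + σ.profit (.inr e.2) = G.weight e)
    (hx : σ.rate x = -1) (hy : σ.rate y ≤ 0) : σ.EventDue := by
  have hxa : σ.status (G.compOf x) = .active := by
    by_contra h; rw [rate_eq_zero h] at hx; norm_num at hx
  have hxm := σ.mem_component_self x
  have hym := σ.mem_component_self y
  have hb : ¬ G.MinOnBoth σ.profit (σ.component x) := fun h => by
    rw [rate_eq_zero_of_minOnBoth h] at hx; norm_num at hx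
  obtain ⟨s, hs⟩ := hσ.exists_hasMinIn hxa hb
  have hxs : sideOf x = s.opp := (s.eq_or_eq_opp (sideOf x)).resolve_left fun h => by
    rw [hσ.rate_eq_one hxa hxm hs h] at hx; norm_num at hx
  have hys : sideOf y = s := by rw [hxy.sideOf_eq, hxs, s.opp_opp]
  have hyx : y ∉ σ.component x := fun h => by
    rw [hσ.rate_eq_one hxa h hs hys] at hy; norm_num at hy
  have hleg : σ.Legitimate e x y :=
    ⟨subparEdge_of_notMem he fun h => hyx (mem_component_of_joins hxy (hσ.start_subset h)), hxy, ht, hxa,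
      hyx, s, hs, hxm, hσ.essentialVertex (.inr hxa), hxs⟩
  cases hst : σ.status (G.compOf y) with
  | frozen => exact ⟨_, .freeze e x y hleg hst⟩
  | bin => exact ⟨_, .grow e x y hleg hst⟩
  | repaired => exact ⟨_, .attach e x y hleg hst⟩
  | active =>
    by_cases hb' : G.MinOnBoth σ.profit (σ.component y)
    · exact ⟨_, .repair y hst hb'⟩
    · obtain ⟨s', hs'⟩ := hσ.exists_hasMinIn hst hb'
      obtain rfl | rfl := s.eq_or_eq_opp s'
      · rw [hσ.rate_eq_one hst hym hs' hys] at hy; norm_num at hy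
      · exact ⟨_, .meet e x y hleg hst ⟨s, hs, hs'⟩⟩

theorem quiet (h : ¬ σ.EventDue) : σ.Quiet := by
  constructor
  · intro q hq hr
    refine lt_of_le_of_ne (hσ.le_profit q hq) fun hΩ => h ?_
    obtain hb | ha := hq
    · exact ⟨_, .activate _ hb (hσ.minShare_supp (.inl hb) hΩ.symm)⟩
    · exact ⟨_, .repair q ha (hσ.minOnBoth_of_rate ha hr hΩ.symm)⟩
  · intro e he hr
    refine lt_of_le_of_ne (hσ.core.weight_le he) fun ht => h ?_
    -- Rates are 1, 0 or −1, so a negative sum has one end falling at rate −1 and the other not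
    -- rising.
    obtain h1 | h1 | h1 := σ.rate_cases (.inl e.1)
    · obtain h2 | h2 | h2 := σ.rate_cases (.inr e.2) <;> rw [h1, h2] at hr <;> norm_num at hr
    · refine hσ.eventDue_of_tight he (joins_self e).symm ht.symm ?_ h1.le
      obtain h2 | h2 | h2 := σ.rate_cases (.inr e.2)
      · rw [h1, h2] at hr; norm_num at hr
      · rw [h1, h2] at hr; norm_num at hr
      · exact h2
    · refine hσ.eventDue_of_tight he (joins_self e) ht.symm h1 ?_
      rw [h1] at hr
      obtain h2 | h2 | h2 := σ.rate_cases (.inr e.2)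
      · rw [h2] at hr; norm_num at hr
      · exact h2.le
      · rw [h2]; norm_num

theorem not_minOnBoth_of_quiet (h : σ.Quiet) {x : U ⊕ V}
    (hx : σ.status (G.compOf x) = .active) : ¬ G.MinOnBoth σ.profit (σ.component x) := fun hb => by
  obtain ⟨q, hq, -, hΩ⟩ := (hσ.attainsMin_iff hx).1 hb.1
  have h0 : σ.rate q = 0 := rate_eq_zero_of_minOnBoth (by rwa [component_eq hq])
  exact (h.lt_profit q (hσ.unsettled_of_mem hx hq) (by rw [h0]; norm_num)).ne' hΩ

/-- At a legitimate edge x falls, so strictness forces y to rise. That excludes every y outside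
Active, and in the meeting case y would be falling. -/
theorem not_eventDue (h : σ.Quiet) : ¬ σ.EventDue := by
  rintro ⟨σ', hσ'⟩
  have key : ∀ e x y, σ.Legitimate e x y → 0 < σ.rate y := fun e x y he => by
    by_contra! hy
    have hadd := Joins.add_eq he.2.1 σ.rate
    have := h.weight_lt e he.1.1 (by rw [← hadd, hσ.rate_of_legitimate he]; linarith)
    exact this.ne' he.2.2.1
  have hsettled : ∀ e x y, σ.Legitimate e x y → σ.status (G.compOf y) ≠ .active → False :=
    fun e x y he hy => (key e x y he).ne' (rate_eq_zero hy)
  cases hσ' with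
  | activate C hC hmin =>
    obtain ⟨q, rfl⟩ := exists_compOf_eq C
    obtain ⟨r, hr, -, hrm⟩ := exists_eq_minShare σ.profit
      (show q ∈ (G.compOf q).supp from rfl) (hσ.essentialVertex (.inl hC))
    have hrb : σ.status (G.compOf r) = .bin := (congrArg σ.status (mem_supp_iff.1 hr)).trans hC
    refine (h.lt_profit r (.inl hrb) ?_).ne' (hrm.trans hmin)
    rw [rate_eq_zero (by simp [hrb])]; norm_num
  | repair x hx hb => exact hσ.not_minOnBoth_of_quiet h hx hb
  | grow e x y he hy => exact hsettled e x y he (by simp [hy])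
  | freeze e x y he hy => exact hsettled e x y he (by simp [hy])
  | attach e x y he hy => exact hsettled e x y he (by simp [hy])
  | meet e x y he hy hopp =>
    obtain ⟨s, hs, hs'⟩ := hopp
    have hypos := key e x y he
    obtain ⟨-, hxy, -, hx, -, t, ht, hxt⟩ := he
    obtain rfl := ht.eq_of_attainsMin hs.2
    have : sideOf y = s.opp.opp := by rw [Joins.sideOf_eq hxy, hxt.2.2]
    rw [hσ.rate_eq_neg_one hy (σ.mem_component_self y) hs' this] at hypos
    norm_num at hypos

/-! ### Raising `Ω` -/

/-- Rotation keeps every edge of T tight, entry vertices of roots rise together with Ω, and settled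
components do not move. -/
theorem advance (hq : σ.Quiet) {t : ℝ} (ht : 0 ≤ t) (hs : σ.Safe t) : (σ.advance t).Valid := by
  obtain ⟨root, hr⟩ := hσ.exists_forest
  have hzero : ∀ q, ¬ σ.Unsettled (G.compOf q) → σ.profit q + t * σ.rate q = σ.profit q :=
    fun q h => by rw [rate_eq_zero fun h' => h (.inr h'), mul_zero, add_zero]
  have htight : ∀ e ∈ σ.T, (σ.profit (.inl e.1) + t * σ.rate (.inl e.1)) +
      (σ.profit (.inr e.2) + t * σ.rate (.inr e.2)) = G.weight e := fun e he => by
    have h1 := hσ.tight e he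
    have h2 := hσ.rate_add he
    linear_combination h1 + t * h2
  have hΩ := hσ.nonneg
  refine ⟨isCore_of_tight (fun q => ?_) hs.weight_le
      (fun e he => htight e (hσ.start_subset he)) fun q hq => ?_,
    add_nonneg hσ.nonneg ht, hσ.start_subset, hσ.mem_edges, htight, hσ.status_eq, hσ.ne_bin,
    hσ.fundamental, hs.le_profit,
    ⟨root, hr.root_active, hr.parent_root, hr.descendent, hr.root_eq, hr.parent_edge,
      hr.entry_nonempty, ?_⟩, ?_⟩
  · by_cases h : σ.Unsettled (G.compOf q)
    · have := hs.le_profit q h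
      show 0 ≤ σ.profit q + t * σ.rate q
      linarith
    · show 0 ≤ σ.profit q + t * σ.rate q
      rw [hzero q h]; exact hσ.core.nonneg q
  · show σ.profit q + t * σ.rate q = 0
    rw [rate_eq_zero_of_not_essentialVertex hq, hσ.core.eq_zero hq, mul_zero, add_zero]
  · intro C hC s hsC
    obtain ⟨c, rfl⟩ := exists_compOf_eq C
    have hC : σ.status (G.compOf c) = .active := hC
    obtain ⟨r, h1, h2, h3, h4⟩ := hσ.root_attains hr hC hsC
    obtain ⟨s', hs'⟩ := hσ.exists_hasMinIn hC (hσ.not_minOnBoth_of_quiet hq hC)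
    obtain rfl := (hσ.mem_entrySides_iff hr hC hs').1 hsC
    refine ⟨r, h2, h3, ?_⟩
    show σ.profit r + t * σ.rate r = σ.Ω + t
    rw [hσ.rate_eq_one hC h1 hs' h3, h4, mul_one]
  · intro C hC
    obtain ⟨θ, h1, h2, h3⟩ := hσ.rigid C hC
    refine ⟨θ, h1.trans (le_add_of_nonneg_right ht), fun q hq he => ?_, fun z hz hle q hq => ?_⟩
    · show θ ≤ σ.profit q + t * σ.rate q
      rw [hzero q (hq ▸ hC)]
      exact h2 q hq he
    · show z q = σ.profit q + t * σ.rate q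
      rw [hzero q (hq ▸ hC)]
      refine h3 z hz (fun r => ?_) q hq
      have hler : θ ≤ z r ∨ z r = σ.profit r + t * σ.rate r := hle r
      -- At an unsettled vertex, equality with the moved profit already gives a value of at least Ω
      -- + t, hence at least θ. The disjunction in `Rigid` thus survives although the reference
      -- imputation changes.
      by_cases hr : σ.Unsettled (G.compOf r)
      · refine .inl (hler.elim id fun h => ?_)
        have := hs.le_profit r hr
        rw [h]; linarith
      · rwa [hzero r hr] at hler

/-- As long as no component has min on both sides, the rates do not change. -/
theorem rate_advance (hq : σ.Quiet) {t : ℝ} (hτ : (σ.advance t).Valid)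
    (hb : ∀ x, σ.status (G.compOf x) = .active →
      ¬ G.MinOnBoth (σ.advance t).profit (σ.component x)) (x : U ⊕ V) :
    (σ.advance t).rate x = σ.rate x := by
  by_cases hx : σ.status (G.compOf x) = .active
  · have hm := σ.mem_component_self x
    obtain ⟨s, hs⟩ := hσ.exists_hasMinIn hx (hσ.not_minOnBoth_of_quiet hq hx)
    have hτs : G.HasMinIn (σ.advance t).profit s ((σ.advance t).component x) := by
      refine ⟨hb x hx, ?_⟩
      obtain ⟨r, hr, hrs, hΩ⟩ := (hσ.attainsMin_iff hx).1 hs.2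
      refine (hτ.attainsMin_iff hx).2 ⟨r, hr, hrs, ?_⟩
      show σ.profit r + t * σ.rate r = σ.Ω + t
      rw [hσ.rate_eq_one hx hr hs hrs, hΩ, mul_one]
    obtain h | h := s.eq_or_eq_opp (sideOf x)
    · rw [hσ.rate_eq_one hx hm hs h, hτ.rate_eq_one hx hm hτs h]
    · rw [hσ.rate_eq_neg_one hx hm hs h, hτ.rate_eq_neg_one hx hm hτs h]
  · rw [rate_eq_zero hx]; exact rate_eq_zero hx

/-- Either side rules out an Active component with min on both sides at time t. The rates are then
still the old ones, and strictness under old and new rates is the same condition. -/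
theorem not_eventDue_advance_iff (hq : σ.Quiet) {t : ℝ} (hτ : (σ.advance t).Valid) :
    ¬ (σ.advance t).EventDue ↔ σ.StrictlySafe t := by
  constructor
  · intro h
    have hτq := hτ.quiet h
    have hrate := hσ.rate_advance hq hτ fun x hx => hτ.not_minOnBoth_of_quiet hτq hx
    refine ⟨fun q hqu hq1 => hτq.lt_profit q hqu (by rwa [hrate]), fun e he hneg =>
      hτq.weight_lt e he (by rwa [hrate, hrate])⟩
  · intro h
    have hrate := hσ.rate_advance hq hτ fun x hx hb => by
      obtain ⟨s, hs⟩ := hσ.exists_hasMinIn hx (hσ.not_minOnBoth_of_quiet hq hx)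
      have hopp : G.AttainsMin (σ.advance t).profit s.opp ((σ.advance t).component x) := by
        cases s
        exacts [hb.2, hb.1]
      obtain ⟨r, hr, hrs, hΩ⟩ := (hτ.attainsMin_iff hx).1 hopp
      refine (h.lt_profit r (hσ.unsettled_of_mem hx hr) ?_).ne' hΩ
      rw [hσ.rate_eq_neg_one hx hr hs hrs]; norm_num
    exact hτ.not_eventDue ⟨fun q hqu hq1 => h.lt_profit q hqu (by rwa [hrate] at hq1),
      fun e he hneg => h.weight_lt e he (by rwa [hrate, hrate] at hneg)⟩

end Valid

/-- The constraints are affine functions of time: the distance of an unsettled profit from Ω, and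
the slack of an edge. Those that decrease start positive by quietness; the others cannot be
violated. -/
theorem Valid.exists_first {σ : State G} (hσ : σ.Valid) (hq : σ.Quiet) (hh : ¬ σ.Halted) :
    ∃ δ > 0, (∀ t, 0 ≤ t → t ≤ δ → σ.Safe t) ∧ (∀ t, 0 ≤ t → t < δ → σ.StrictlySafe t) ∧
      ¬ σ.StrictlySafe δ := by
  let a : {q // σ.Unsettled (G.compOf q)} ⊕ {e // e ∈ G.edges} → ℝ :=
    Sum.elim (fun q => σ.profit q - σ.Ω)
      fun e => σ.profit (.inl e.1.1) + σ.profit (.inr e.1.2) - G.weight e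
  let b : {q // σ.Unsettled (G.compOf q)} ⊕ {e // e ∈ G.edges} → ℝ :=
    Sum.elim (fun q => 1 - σ.rate q)
      fun e => -(σ.rate (.inl e.1.1) + σ.rate (.inr e.1.2))
  have hab : ∀ i, 0 < b i → 0 < a i := by
    rintro (⟨q, hqu⟩ | ⟨e, he⟩) h
    · have h : 0 < 1 - σ.rate q := h
      exact sub_pos.2 (hq.lt_profit q hqu (by linarith))
    · exact sub_pos.2 (hq.weight_lt e he (neg_pos.1 h))
  -- Some constraint is approached: Ω catches up with a fixed profit in Bin, or with a falling
  -- profit in Active.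
  have hb : ∃ i, 0 < b i := by
    simp only [Halted, not_forall] at hh
    obtain ⟨C, hC⟩ := hh
    obtain ⟨q, rfl⟩ := exists_compOf_eq C
    by_cases hbin : σ.status (G.compOf q) = .bin
    · exact ⟨.inl ⟨q, .inl hbin⟩, by
        show 0 < 1 - σ.rate q
        rw [rate_eq_zero (by simp [hbin])]; norm_num⟩
    · have hact : σ.status (G.compOf q) = .active := by_contra fun h => hC ⟨hbin, h⟩
      obtain ⟨s, hs⟩ := hσ.exists_hasMinIn hact (hσ.not_minOnBoth_of_quiet hq hact)
      obtain ⟨r, hr, hrs⟩ := (hσ.essentialVertex (.inr hact)).exists_side s.opp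
      exact ⟨.inl ⟨r, .inr (hr ▸ hact)⟩, by
        show 0 < 1 - σ.rate r
        rw [hσ.rate_eq_neg_one hact (hσ.mem_component_of_compOf_eq hr) hs hrs]; norm_num⟩
  obtain ⟨δ, hδ, h1, h2, i, hi, h3⟩ := exists_first_zero a b hab hb
  refine ⟨δ, hδ, fun t ht0 ht => ⟨fun q hqu => ?_, fun e he => ?_⟩,
    fun t ht0 ht => ⟨fun q hqu hr => ?_, fun e he hr => ?_⟩, fun h => ?_⟩
  · obtain h | h := (σ.rate_le_one q).lt_or_eq
    · have : t * (1 - σ.rate q) ≤ σ.profit q - σ.Ω := h1 t ht (.inl ⟨q, hqu⟩) (sub_pos.2 h)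
      linarith
    · have := hσ.le_profit q hqu
      rw [h]; linarith
  · by_cases h : σ.rate (.inl e.1) + σ.rate (.inr e.2) < 0
    · have : t * -(σ.rate (.inl e.1) + σ.rate (.inr e.2)) ≤
        σ.profit (.inl e.1) + σ.profit (.inr e.2) - G.weight e :=
        h1 t ht (.inr ⟨e, he⟩) (neg_pos.2 h)
      linarith
    · have := hσ.core.weight_le he
      have := mul_nonneg ht0 (not_lt.1 h)
      linarith
  · have : t * (1 - σ.rate q) < σ.profit q - σ.Ω :=
      h2 t ht (.inl ⟨q, hqu⟩) (sub_pos.2 (lt_of_le_of_ne (σ.rate_le_one q) hr))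
    linarith
  · have : t * -(σ.rate (.inl e.1) + σ.rate (.inr e.2)) <
      σ.profit (.inl e.1) + σ.profit (.inr e.2) - G.weight e :=
      h2 t ht (.inr ⟨e, he⟩) (neg_pos.2 hr)
    linarith
  · obtain ⟨q, hqu⟩ | ⟨e, he⟩ := i
    · have hi : 0 < 1 - σ.rate q := hi
      have h3 : δ * (1 - σ.rate q) = σ.profit q - σ.Ω := h3
      have := h.lt_profit q hqu (by linarith)
      linarith
    · have hi : 0 < -(σ.rate (.inl e.1) + σ.rate (.inr e.2)) := hi
      have h3 : δ * -(σ.rate (.inl e.1) + σ.rate (.inr e.2)) =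
        σ.profit (.inl e.1) + σ.profit (.inr e.2) - G.weight e := h3
      have := h.weight_lt e he (by linarith)
      linarith

namespace Valid

variable {σ : State G} (hσ : σ.Valid)
include hσ

theorem exists_nextEventAfter (hd : ¬ σ.EventDue) (hh : ¬ σ.Halted) :
    ∃ δ, σ.NextEventAfter δ ∧ ∀ t, 0 ≤ t → t ≤ δ → (σ.advance t).Valid := by
  have hq := hσ.quiet hd
  obtain ⟨δ, hδ, h1, h2, h3⟩ := hσ.exists_first hq hh
  have hv : ∀ t, 0 ≤ t → t ≤ δ → (σ.advance t).Valid :=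
    fun t ht0 ht => hσ.advance hq ht0 (h1 t ht0 ht)
  refine ⟨δ, ⟨hh, hδ, ?_, fun t ht0 ht => ?_⟩, hv⟩
  · by_contra h
    exact h3 ((hσ.not_eventDue_advance_iff hq (hv δ hδ.le le_rfl)).1 h)
  · exact (hσ.not_eventDue_advance_iff hq (hv t ht0 ht.le)).2 (h2 t ht0 ht)

theorem advance_of_nextEventAfter {δ : ℝ} (h : σ.NextEventAfter δ) {t : ℝ} (ht0 : 0 ≤ t)
    (ht : t ≤ δ) : (σ.advance t).Valid := by
  -- The constructed event time δ' cannot precede δ, which is a first event time, so validity up to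
  -- δ' covers the whole interval.
  obtain ⟨δ', h', hv⟩ := hσ.exists_nextEventAfter h.not_eventDue h.1
  refine hv t ht0 (ht.trans ?_)
  by_contra! hlt
  exact h.2.2.2 δ' h'.2.1.le hlt h'.2.2.1

theorem halted_or_exists_step : σ.Halted ∨ ∃ σ', Step σ σ' := by
  by_cases hd : σ.EventDue
  · obtain ⟨σ', h⟩ := hd
    exact .inr ⟨σ', .event σ' h⟩
  · by_cases hh : σ.Halted
    · exact .inl hh
    · obtain ⟨δ, h, -⟩ := hσ.exists_nextEventAfter hd hh
      exact .inr ⟨_, .raise δ h⟩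

theorem step {σ' : State G} (h : Step σ σ') : σ'.Valid := by
  cases h with
  | event _ h => exact (hσ.event h).valid
  | raise δ h => exact hσ.advance_of_nextEventAfter h h.2.1.le le_rfl

theorem reaches {τ : State G} (h : σ.Reaches τ) : τ.Valid := by
  induction h with
  | refl => exact hσ
  | tail _ h ih => exact ih.step h

end Valid

end State
end AssignmentGame

/-! ### Lexicographic optimality, termination and progress -/

/-- Comparison of sorted lists through multiplicities. -/
theorem List.lex_of_count_lt {α : Type*} [LinearOrder α] {m : α} :
    ∀ {l₁ l₂ : List α}, l₁.Pairwise (· ≤ ·) → l₂.Pairwise (· ≤ ·) → l₁.length = l₂.length →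
      l₂.count m < l₁.count m → (∀ b < m, l₁.count b = l₂.count b) → List.Lex (· < ·) l₁ l₂
  | [], _, _, _, _, h, _ => by simp at h
  | _ :: _, [], _, _, h, _, _ => by simp at h
  | a :: l₁, b :: l₂, h₁, h₂, hlen, hm, hlt => by
    obtain hab | rfl | hba := lt_trichotomy a b
    · exact .rel hab
    · refine .cons (List.lex_of_count_lt (m := m) h₁.of_cons h₂.of_cons (by simpa using hlen) ?_
        fun c hc => ?_)
      · simpa [List.count_cons] using hm
      · simpa [List.count_cons] using hlt c hc
    -- If the second list had the smaller head, the first list would contain nothing up to that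
    -- head, against the hypothesis on counts below m or at m.
    · have h0 : ∀ c ≤ b, (a :: l₁).count c = 0 := fun c hc => by
        refine List.count_eq_zero.2 fun hmem => ?_
        obtain rfl | hmem := List.mem_cons.1 hmem
        · exact absurd hba hc.not_gt
        · exact absurd (List.rel_of_pairwise_cons h₁ hmem) (hc.trans_lt hba).not_ge
      obtain hbm | hbm := lt_or_ge b m
      · have := hlt b hbm
        rw [h0 b le_rfl] at this
        simp at this
      · rw [h0 m hbm] at hm
        simp at hm

namespace AssignmentGame

variable {U V : Type*} {G : AssignmentGame U V}

namespace State

variable {σ : State G}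

/-- `y` is consistent with being the output of the mechanism from `σ` on: settled profits are
final, the others will not fall below `Ω`. -/
structure Settles (σ : State G) (y : U ⊕ V → ℝ) : Prop where
  eq_profit : ∀ q, ¬ σ.Unsettled (G.compOf q) → y q = σ.profit q
  le : ∀ q, σ.Unsettled (G.compOf q) → σ.Ω ≤ y q

theorem Settles.of_advance {y : U ⊕ V → ℝ} {t δ : ℝ} (htδ : t ≤ δ)
    (h : (σ.advance δ).Settles y) : (σ.advance t).Settles y := by
  refine ⟨fun q hq => (h.eq_profit q hq).trans ?_, fun q hq => le_trans ?_ (h.le q hq)⟩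
  · show σ.profit q + δ * σ.rate q = σ.profit q + t * σ.rate q
    have h0 : σ.rate q = 0 := rate_eq_zero fun h' => hq (.inr h')
    rw [h0, mul_zero, mul_zero]
  · exact add_le_add_right htδ σ.Ω

end State

variable [Fintype U] [Fintype V]

theorem mem_essentialVertices {q : U ⊕ V} :
    q ∈ G.essentialVertices ↔ G.EssentialVertex q := by
  simp [essentialVertices]

theorem pairwise_sortedProfits (p : U ⊕ V → ℝ) :
    (G.sortedProfits p).Pairwise (· ≤ ·) :=
  Multiset.pairwise_sort _ _

theorem length_sortedProfits (p : U ⊕ V → ℝ) :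
    (G.sortedProfits p).length = G.essentialVertices.card := by
  simp [sortedProfits]

open Classical in
theorem count_sortedProfits (p : U ⊕ V → ℝ) (b : ℝ) :
    (G.sortedProfits p).count b = (G.essentialVertices.filter fun q => b = p q).card := by
  rw [← Multiset.coe_count, sortedProfits, Multiset.sort_eq, Multiset.count_map]
  rfl

/-- If `z` has a smaller minimum than `p` on the vertices where they differ, then `z` is
lexicographically smaller. -/
theorem lex_sortedProfits {z p : U ⊕ V → ℝ} {r : U ⊕ V} (hr : G.EssentialVertex r)
    (hne : z r ≠ p r) (hz : ∀ q, z q ≠ p q → z r ≤ z q) (hp : ∀ q, z q ≠ p q → z r < p q) :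
    List.Lex (· < ·) (G.sortedProfits z) (G.sortedProfits p) := by
  classical
  refine List.lex_of_count_lt (m := z r) (pairwise_sortedProfits z) (pairwise_sortedProfits p)
    (by rw [length_sortedProfits, length_sortedProfits]) ?_ fun b hb => ?_
  · rw [count_sortedProfits, count_sortedProfits]
    refine Finset.card_lt_card ((Finset.ssubset_iff_of_subset fun q hq => ?_).2
      ⟨r, by simpa [mem_essentialVertices] using hr, by simp [hne]⟩)
    rw [Finset.mem_filter] at hq ⊢
    refine ⟨hq.1, hq.2.trans ?_⟩
    by_contra h
    exact (hp q fun h' => h h'.symm).ne hq.2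
  · rw [count_sortedProfits, count_sortedProfits]
    refine congrArg _ (Finset.filter_congr fun q _ => ?_)
    by_cases h : z q = p q
    · rw [h]
    · refine ⟨fun h' => ?_, fun h' => ?_⟩
      · exact absurd (hz q h) (h' ▸ hb).not_ge
      · exact absurd (hp q h) (h' ▸ hb).not_gt

theorem exists_essentialVertex (hE : G.edges.Nonempty) : ∃ q, G.EssentialVertex q := by
  obtain ⟨p, hp⟩ := G.exists_isCore
  obtain ⟨e, he⟩ := hE
  by_contra! h
  have := hp.weight_le he
  rw [hp.eq_zero (h _), hp.eq_zero (h _)] at this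
  linarith [G.weight_pos e he]

/-- Initially Ω is the least essential profit, so it serves as threshold for every frozen component;
rigidity there is uniqueness of the imputation. -/
theorem valid_startState (hE : G.edges.Nonempty) {p : U ⊕ V → ℝ} (hp : G.IsCore p) :
    (G.startState p).Valid := by
  classical
  have hun : ∀ C, (G.startState p).Unsettled C → ¬ G.UniqueImputation C := fun C h hC => by
    simp [State.Unsettled, startState, hC] at h
  have hact : ∀ C, (G.startState p).status C ≠ .active := fun C => by
    by_cases h : G.UniqueImputation C <;> simp [startState, h]
  have hle : ∀ q, G.EssentialVertex q → (G.startState p).Ω ≤ p q :=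
    fun q hq => minShare_le p (Set.mem_univ q) hq
  refine ⟨hp, ?_, subset_rfl, fun e he => mem_edges_of_mem_startEdges he, fun e he => hp.tight he,
    fun e he => congrArg _ (compOf_eq he), fun e he h => absurd he h, hun,
    fun q hq => hle q (essentialVertex_of_not_uniqueImputation (hun _ hq) rfl),
    ⟨id, fun C h => absurd h (hact C), fun C h => absurd h (hact C), fun C h => absurd h (hact C),
      fun e _ h => absurd h (hact _), fun A C h => absurd h (hact C), fun C h => absurd h (hact C),
      fun C h => absurd h (hact C)⟩, fun C hC => ⟨_, le_rfl, fun q _ hq => hle q hq, ?_⟩⟩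
  · obtain ⟨q, hq⟩ := exists_essentialVertex hE
    obtain ⟨r, -, -, h⟩ := exists_eq_minShare p (Set.mem_univ q) hq
    exact (hp.nonneg r).trans_eq h
  · intro z hz _ q hq
    have hC : G.UniqueImputation C := by
      by_contra h
      exact hC (.inl (by simp [startState, h]))
    exact hC z p hz hp q hq

namespace State

variable {σ τ : State G}

/-! ### The output -/

/-- When the mechanism halts, its output beats every other core imputation. -/
theorem Valid.lex_of_halted (hσ : σ.Valid) (hh : σ.Halted) {z : U ⊕ V → ℝ} (hz : G.IsCore z)
    (hne : z ≠ σ.profit) :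
    List.Lex (· < ·) (G.sortedProfits z) (G.sortedProfits σ.profit) := by
  have hess : ∀ q, z q ≠ σ.profit q → G.EssentialVertex q := fun q h => by
    by_contra hq
    exact h (by rw [hz.eq_zero hq, hσ.core.eq_zero hq])
  have hD : {q | z q ≠ σ.profit q}.Nonempty := Function.ne_iff.1 hne
  obtain ⟨r, hr, hrmin⟩ := Set.exists_min_image _ z (Set.toFinite _) hD
  obtain ⟨t, ht, htmin⟩ := Set.exists_min_image _ σ.profit (Set.toFinite _) hD
  refine lex_sortedProfits (hess r hr) hr hrmin fun q hq => lt_of_lt_of_le ?_ (htmin q hq)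
  -- Otherwise z is at least the profit at t wherever the two differ. The threshold of the component
  -- of t is at most that profit, so rigidity forces agreement at t.
  by_contra! hle
  obtain ⟨θ, -, hθ, hrig⟩ := hσ.rigid (G.compOf t) fun h => h.elim (hh _).1 (hh _).2
  refine ht (hrig z hz (fun q => ?_) t rfl)
  by_cases hq : z q = σ.profit q
  · exact .inr hq
  · exact .inl ((hθ t rfl (hess t ht)).trans (hle.trans (hrmin q hq)))

theorem Valid.profit_eq_of_halted (hσ : σ.Valid) (hσh : σ.Halted) (hτ : τ.Valid)
    (hτh : τ.Halted) : σ.profit = τ.profit := by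
  by_contra h
  exact asymm (hτ.lex_of_halted hτh hσ.core h) (hσ.lex_of_halted hσh hτ.core (Ne.symm h))

/-! ### Termination -/

open Classical in
/-- A natural number that every step decreases. -/
noncomputable def stepPotential (σ : State G) : ℕ :=
  2 * σ.potential + if σ.EventDue then 0 else 1

theorem Valid.stepPotential_lt (hσ : σ.Valid) (h : Step σ τ) :
    τ.stepPotential < σ.stepPotential := by
  cases h with
  | event _ h =>
    have := (hσ.event h).potential_lt
    -- The factor 2 pays for the indicator, which an event may raise from 0 to 1.
    unfold stepPotential
    split_ifs <;> omega
  | raise δ h =>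
    have hpot : (σ.advance δ).potential = σ.potential := rfl
    rw [stepPotential, stepPotential, if_pos h.2.2.1, if_neg h.not_eventDue, hpot]
    omega

theorem Valid.exists_halted (hσ : σ.Valid) : ∃ τ, σ.Reaches τ ∧ τ.Halted := by
  induction hn : σ.stepPotential using Nat.strong_induction_on generalizing σ with
  | _ n ih =>
    obtain hh | ⟨σ', h⟩ := hσ.halted_or_exists_step
    · exact ⟨σ, .refl, hh⟩
    · obtain ⟨τ, h1, h2⟩ := ih _ (hn ▸ hσ.stepPotential_lt h) (hσ.step h) rfl
      exact ⟨τ, .head h h1, h2⟩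

theorem Valid.not_exists_run (hσ : σ.Valid) :
    ¬ ∃ run : ℕ → State G, run 0 = σ ∧ ∀ n, Step (run n) (run (n + 1)) := by
  rintro ⟨run, h0, hrun⟩
  have hv : ∀ n, (run n).Valid := fun n => by
    induction n with
    | zero => rwa [h0]
    | succ n ih => exact ih.step (hrun n)
  have hbound : ∀ n, (run n).stepPotential + n ≤ (run 0).stepPotential := fun n => by
    induction n with
    | zero => simp
    | succ n ih => have := (hv n).stepPotential_lt (hrun n); omega
  have := hbound ((run 0).stepPotential + 1)
  omega

/-! ### Progress -/

/-- Information about the output passes backwards in time. A component settled in this very step has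
its final profits, which are at least the current Ω. -/
theorem Settles.of_step {y : U ⊕ V → ℝ} (hσ : σ.Valid) (hst : Step σ τ) (h : τ.Settles y) :
    σ.Settles y := by
  cases hst with
  | event _ hev =>
    obtain ⟨-, hp, hΩ, hun, -⟩ := hσ.event hev
    refine ⟨fun q hq => hp ▸ h.eq_profit q fun h' => hq (hun _ h'), fun q hq => ?_⟩
    by_cases hq' : τ.Unsettled (G.compOf q)
    · exact hΩ ▸ h.le q hq'
    · rw [h.eq_profit q hq', hp]
      exact hσ.le_profit q hq
  | raise δ hδ =>
    have := Settles.of_advance hδ.2.1.le h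
    rwa [advance_zero] at this

theorem Valid.settles (hσ : σ.Valid) (hτ : σ.Reaches τ) (hh : τ.Halted) :
    σ.Settles τ.profit := by
  induction hτ using Relation.ReflTransGen.head_induction_on with
  | refl => exact ⟨fun q _ => rfl, fun q hq => absurd hq fun h => h.elim (hh _).1 (hh _).2⟩
  | head h _ ih => exact .of_step hσ h (ih (hσ.step h))

theorem Settles.exists_le {y : U ⊕ V → ℝ} (hσ : σ.Valid) (h : σ.Settles y) (hh : ¬ σ.Halted) :
    ∃ q, G.EssentialVertex q ∧ σ.Ω ≤ y q := by
  simp only [Halted, not_forall] at hh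
  obtain ⟨C, hC⟩ := hh
  obtain ⟨q, rfl⟩ := exists_compOf_eq C
  have hq : σ.Unsettled (G.compOf q) := by
    by_contra h'
    exact hC ⟨fun h => h' (.inl h), fun h => h' (.inr h)⟩
  exact ⟨q, hσ.essentialVertex hq, h.le q hq⟩

/-- Any valid state has some run to a halt, and the output of that run is y. No particular
continuation has to be fixed. -/
theorem Valid.settles_of_forall_halted {y : U ⊕ V → ℝ}
    (hy : ∀ τ : State G, τ.Valid → τ.Halted → τ.profit = y) (hσ : σ.Valid) : σ.Settles y := by
  obtain ⟨τ, h1, h2⟩ := hσ.exists_halted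
  exact hy τ (hσ.reaches h1) h2 ▸ hσ.settles h1 h2

/-- What holds at all times of a run. -/
theorem Occurs.spec {y : U ⊕ V → ℝ} (hy : ∀ τ : State G, τ.Valid → τ.Halted → τ.profit = y)
    (hσ : σ.Valid) (h0 : ∃ q, G.EssentialVertex q ∧ σ.Ω ≤ y q) (h : σ.Occurs τ) :
    τ.Valid ∧ τ.Settles y ∧ ∃ q, G.EssentialVertex q ∧ τ.Ω ≤ y q := by
  have hadv : ∀ ρ : State G, ρ.Valid → ∀ δ, ρ.NextEventAfter δ → ∀ t, 0 ≤ t → t ≤ δ →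
      (ρ.advance t).Valid ∧ (ρ.advance t).Settles y ∧
        ∃ q, G.EssentialVertex q ∧ (ρ.advance t).Ω ≤ y q := by
    intro ρ hρ δ hδ t ht0 ht
    have hv := hρ.advance_of_nextEventAfter hδ ht0 ht
    have hs := ((hρ.advance_of_nextEventAfter hδ hδ.2.1.le le_rfl).settles_of_forall_halted
      hy).of_advance ht
    exact ⟨hv, hs, hs.exists_le hv hδ.1⟩
  obtain ⟨ρ, hρ, h⟩ := h
  obtain rfl | ⟨δ, hδ, t, ht0, ht, rfl⟩ := h
  · have hv := hσ.reaches hρ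
    refine ⟨hv, hv.settles_of_forall_halted hy, ?_⟩
    clear hv
    induction hρ with
    | refl => exact h0
    | @tail ρ τ hρ hst ih =>
      have hv := hσ.reaches hρ
      cases hst with
      | event _ hev => rw [(hv.event hev).Ω_eq]; exact ih
      | raise δ hδ => exact (hadv ρ hv δ hδ δ hδ.2.1.le le_rfl).2.2
  · exact hadv ρ (hσ.reaches hρ) δ hδ t ht0 ht

end State

theorem exists_le_share (p : U ⊕ V → ℝ) {q : U ⊕ V} (hq : G.EssentialVertex q) :
    ∃ l, p q = G.share p l := by
  classical
  have hmem : p q ∈ G.shareSet p := Finset.mem_image_of_mem p (mem_essentialVertices.2 hq)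
  have : p q ∈ Set.range ((G.shareSet p).orderEmbOfFin rfl) := by
    rw [Finset.range_orderEmbOfFin]; exact hmem
  obtain ⟨l, hl⟩ := this
  exact ⟨l, hl.symm⟩

end AssignmentGame

theorem mainTheorem1 {U V : Type*} [Fintype U] [Fintype V] (G : AssignmentGame U V)
    (hE : G.edges.Nonempty) :
    -- there is exactly one leximin core imputation `y`
    ∃ y : U ⊕ V → ℝ, G.IsLeximin y ∧ (∀ z, G.IsLeximin z → z = y) ∧
      -- `last` is the index of the largest profit share that `y` gives to an essential vertex
      ∃ last : Fin (G.shareSet y).card, (∀ l, l ≤ last) ∧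
        -- for every starting core imputation and every order of executing simultaneous events:
        ∀ p : U ⊕ V → ℝ, G.IsCore p →
          -- progress: the current imputation is in the core at all times, and it is processed up
          -- to level `l` when `Ω` is the `l`-th share plus `ε`
          (∀ σ, (G.startState p).Occurs σ → G.IsCore σ.profit ∧
            ∀ (l : Fin (G.shareSet y).card) (ε : ℝ), 0 < ε → σ.Ω = G.share y l + ε →
              G.AgreesUpTo y l σ.profit) ∧
          -- termination: there is no infinite run,
          (¬ ∃ run : ℕ → AssignmentGame.State G, run 0 = G.startState p ∧
            ∀ n, AssignmentGame.State.Step (run n) (run (n + 1))) ∧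
          -- a run can stop only by halting,
          (∀ σ, (G.startState p).Reaches σ → σ.Halted ∨ ∃ σ', AssignmentGame.State.Step σ σ') ∧
          -- it halts by time `share last + ε` for every `ε > 0`, and then it outputs `y`
          (∀ σ, (G.startState p).Occurs σ → ∀ ε : ℝ, 0 < ε → σ.Ω ≤ G.share y last + ε) ∧
          (∀ σ, (G.startState p).Reaches σ → σ.Halted → σ.profit = y) := by
  -- The leximin imputation is obtained as the output of one run from an arbitrary core imputation.
  obtain ⟨p₀, hp₀⟩ := G.exists_isCore
  have hv₀ := AssignmentGame.valid_startState hE hp₀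
  obtain ⟨τ, hτ, hτh⟩ := hv₀.exists_halted
  have hτv := hv₀.reaches hτ
  have hy : ∀ σ : AssignmentGame.State G, σ.Valid → σ.Halted → σ.profit = τ.profit :=
    fun σ hσ hh => hσ.profit_eq_of_halted hh hτv hτh
  obtain ⟨q₀, hq₀⟩ := AssignmentGame.exists_essentialVertex hE
  obtain ⟨l₀, -⟩ := AssignmentGame.exists_le_share (G := G) τ.profit hq₀
  have hpos : 0 < (G.shareSet τ.profit).card := l₀.pos
  refine ⟨τ.profit, ⟨hτv.core, fun z hz => ?_⟩, fun z hz => ?_,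
    ⟨(G.shareSet τ.profit).card - 1, by omega⟩, fun l => Fin.mk_le_mk.2 (by omega),
    fun p hp => ?_⟩
  · by_cases h : z = τ.profit
    · exact .inl (by rw [h])
    · exact .inr (hτv.lex_of_halted hτh hz h)
  · by_contra h
    have h1 := hτv.lex_of_halted hτh hz.1 h
    obtain h2 | h2 := hz.2 _ hτv.core
    · rw [h2] at h1; exact irrefl _ h1
    · exact asymm h1 h2
  · have hv := AssignmentGame.valid_startState hE hp
    have h0 : ∃ q, G.EssentialVertex q ∧ (G.startState p).Ω ≤ τ.profit q := by
      refine ⟨q₀, hq₀, ?_⟩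
      have hs := hv.settles_of_forall_halted hy
      by_cases h : (G.startState p).Unsettled (G.compOf q₀)
      · exact hs.le q₀ h
      · rw [hs.eq_profit q₀ h]
        exact AssignmentGame.minShare_le p (Set.mem_univ q₀) hq₀
    refine ⟨fun σ hσ => ?_, hv.not_exists_run, fun σ hσ => (hv.reaches hσ).halted_or_exists_step,
      fun σ hσ ε hε => ?_, fun σ hσ hh => hy σ (hv.reaches hσ) hh⟩
    · obtain ⟨h1, h2, -⟩ := hσ.spec hy hv h0
      -- An unsettled vertex ends at Ω or above, hence strictly above level l, so vertices of the
      -- lower levels are settled and final.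
      refine ⟨h1.core, fun l ε hε hΩ j hj q hq => (h2.eq_profit q fun h => ?_).symm⟩
      have h3 := h2.le q h
      have h4 := (G.share τ.profit).monotone hj
      linarith
    · obtain ⟨-, -, q, hq, hle⟩ := hσ.spec hy hv h0
      obtain ⟨l, hl⟩ := AssignmentGame.exists_le_share τ.profit hq
      have := (G.share τ.profit).monotone (show l ≤ ⟨(G.shareSet τ.profit).card - 1, by omega⟩ from
        Fin.mk_le_mk.2 (by omega))
      linarith
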